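/- **Setup.** For each number of sectors $S\in\mathbb N$ let $N=N_S$ be the number of regions, and let the random variables $Y_i(0),\ \beta_{is},\ w_{is},\ U_i\in\mathbb R^p,\ \mathcal Z_s\in\mathbb R^p,\ \mathcal X_s$ and the random functions $L_i(x_1,\dots,x_S)$ ($i=1,\dots,N$, $s=1,\dots,S$) be defined on a probability space that may depend on $S$ (a triangular array; the index $S$ is suppressed, $p$ is fixed). Shares satisfy $w_{is}\ge 0$ and $\sum_s w_{is}\le 1$ almost surely; they may be random. Potential outcomes are $$Y_i(x_1,\dots,x_S)=Y_i(0)+\sum_{s}w_{is}x_s\beta_{is}+L_i(x_1,\dots,x_S).$$ One observes $Y_i=Y_i(\mathcal X_1,\dots,\mathcal X_S)$, the shift-share regressor $X_i=\sum_s w_{is}\mathcal X_s$ and the controls $Z_i=\sum_s w_{is}\mathcal Z_s+U_i$. Put $L_i=L_i(\mathcal X_1,\dots,\mathcal X_S)$, $n_s=\sum_i w_{is}$, $\mathcal F_0=\sigma(\mathcal Z,U,Y(0),B,W)$ with $B=(\beta_{is})$, $W=(w_{is})$, and $\sigma_s^2=\operatorname{var}(\mathcal X_s\mid\mathcal F_0)$.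 Let $\ddot X=X-Z(Z'Z)^{-1}Z'X$ and let $\hat\beta=\ddot X'Y/\ddot X'\ddot X$ be the OLS coefficient on $X_i$ in the regression of $Y_i$ on $(X_i,Z_i)$. **Assumptions** (limits as $S\to\infty$; all bounds are constants that do not depend on $S$, $i$, $s$). 1. There is a fixed $\gamma\in\mathbb R^p$ with $E[\mathcal X_s\mid\mathcal F_0]=\mathcal Z_s'\gamma$ for every $s$. 2. Conditionally on $\mathcal F_0$, the shifters $\mathcal X_1,\dots,\mathcal X_S$ are independent. 3. $\max_s n_s/N\to 0$ in probability. 4. $N^{-1}\sum_i E[(U_i'\gamma)^2]\to 0$. 5. $|\beta_{is}|$ is almost surely bounded by a constant. 6. $N^{-1}\sum_i\sum_s w_{is}^2\sigma_s^2$ converges in probability to a non-random strictly positive limit. 7. For some $\nu>0$, $E[|\mathcal X_s|^{2+\nu}\mid\mathcal F_0]$ exists and is uniformly bounded; $E[Y_i(0)^2\mid W]$, and $E[U_{ik}^2\mid W]$, $E[\mathcal Z_{sk}^2\mid W]$ for every component $k$, exist and are uniformly bounded. 8. $E[L_i^2]<\infty$ for all $i$, and $N^{-1}\sum_i E[L_i^2]^{1/2}\to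 0$. 9. $Z'Z/N$ converges in probability to a non-random positive definite matrix. **Proposition 3.** With probability approaching one, $Z'Z$ is invertible, $\ddot X'\ddot X>0$ and $\sum_{i,s}w_{is}^2\sigma_s^2>0$, so that $\hat\beta$ and $$\bar\beta=\frac{\sum_{i}\sum_{s}w_{is}^2\sigma_s^2\beta_{is}}{\sum_{i}\sum_{s}w_{is}^2\sigma_s^2}$$ are well defined, and $$\hat\beta-\bar\beta\to 0\quad\text{in probability as } S\to\infty .$$ If moreover the effects are homogeneous, i.e. $\beta_{is}=\beta$ almost surely for all $i,s$ with $\beta$ a constant (which may depend on $S$), then $\bar\beta=\beta$ with probability approaching one and $\hat\beta-\beta\to 0$ in probability. -/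

import Mathlib

open MeasureTheory ProbabilityTheory Filter Topology Matrix

/-- Convergence in probability to a constant, for a triangular array: the `S`-th variable may live
on its own probability space. -/
def ConvInProb {Ω : ℕ → Type*} [∀ S, MeasurableSpace (Ω S)] (P : ∀ S, Measure (Ω S))
    (A : ∀ S, Ω S → ℝ) (a : ℝ) : Prop :=
  ∀ ε : ℝ, 0 < ε → Tendsto (fun S => P S {ω | ε ≤ |A S ω - a|}) atTop (𝓝 0)

/-- The real random variables `X s` are mutually independent conditionally on `m`. On a standard
Borel space this is `ProbabilityTheory.iCondIndepFun`; no such restriction is needed here. -/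
def CondIndepGiven {Ω ι : Type*} (m : MeasurableSpace Ω) [MeasurableSpace Ω] (P : Measure Ω)
    (X : ι → Ω → ℝ) : Prop :=
  ∀ (T : Finset ι) (A : ι → Set ℝ), (∀ s ∈ T, MeasurableSet (A s)) →
    P⟦⋂ s ∈ T, X s ⁻¹' A s | m⟧ =ᵐ[P] ∏ s ∈ T, P⟦X s ⁻¹' A s | m⟧

/-- `E[f | m]` exists and is bounded by `C` almost surely, for a nonnegative `f`. -/
def CondMeanLE {Ω : Type*} (m : MeasurableSpace Ω) [MeasurableSpace Ω] (P : Measure Ω)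
    (f : Ω → ℝ) (C : ℝ) : Prop :=
  Integrable f P ∧ ∀ᵐ ω ∂P, (P[f | m]) ω ≤ C

/-- The random variables that generate one row of the triangular array, with `S` sectors, `N`
regions and `p` controls. -/
structure ShiftShare (S N p : ℕ) (Ω : Type*) [MeasurableSpace Ω] where
  /-- potential outcome `Y_i(0)` in the absence of shocks -/
  Y0 : Fin N → Ω → ℝ
  /-- treatment effects `β_is` -/
  B : Fin N → Fin S → Ω → ℝ
  /-- shares `w_is` -/
  w : Fin N → Fin S → Ω → ℝ
  /-- measurement errors `U_ik` in the controls -/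
  U : Fin N → Fin p → Ω → ℝ
  /-- sector-level controls (the calligraphic `Z_sk`) -/
  ZZ : Fin S → Fin p → Ω → ℝ
  /-- sector-level shifters (the calligraphic `X_s`) -/
  XX : Fin S → Ω → ℝ
  /-- linearization error `L_i(x_1, …, x_S)` of the potential outcomes -/
  Lfun : Fin N → (Fin S → ℝ) → Ω → ℝ
  measurable_Y0 : ∀ i, Measurable (Y0 i)
  measurable_B : ∀ i s, Measurable (B i s)
  measurable_w : ∀ i s, Measurable (w i s)
  measurable_U : ∀ i k, Measurable (U i k)
  measurable_ZZ : ∀ s k, Measurable (ZZ s k)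
  measurable_XX : ∀ s, Measurable (XX s)
  measurable_Lfun : ∀ i, Measurable fun ω => Lfun i (fun s => XX s ω) ω

namespace ShiftShare

variable {S N p : ℕ} {Ω : Type*} [MeasurableSpace Ω]

/-- `Y_i(x_1, …, x_S) = Y_i(0) + ∑_s w_is x_s β_is + L_i(x_1, …, x_S)`. -/
def potentialOutcome (D : ShiftShare S N p Ω) (i : Fin N) (x : Fin S → ℝ) (ω : Ω) : ℝ :=
  D.Y0 i ω + ∑ s, D.w i s ω * x s * D.B i s ω + D.Lfun i x ω

/-- Realized linearization error `L_i`. -/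
def L (D : ShiftShare S N p Ω) (i : Fin N) (ω : Ω) : ℝ :=
  D.Lfun i (fun s => D.XX s ω) ω

/-- Observed outcomes. -/
def Y (D : ShiftShare S N p Ω) (ω : Ω) : Fin N → ℝ :=
  fun i => D.potentialOutcome i (fun s => D.XX s ω) ω

/-- Shift-share regressor `X_i = ∑_s w_is X_s`. -/
def X (D : ShiftShare S N p Ω) (ω : Ω) : Fin N → ℝ :=
  fun i => ∑ s, D.w i s ω * D.XX s ω

/-- Observed controls `Z_i = ∑_s w_is Z_s + U_i`, as an `N × p` matrix. -/
def Z (D : ShiftShare S N p Ω) (ω : Ω) : Matrix (Fin N) (Fin p) ℝ :=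
  Matrix.of fun i k => ∑ s, D.w i s ω * D.ZZ s k ω + D.U i k ω

/-- Sector size `n_s = ∑_i w_is`. -/
def n (D : ShiftShare S N p Ω) (s : Fin S) (ω : Ω) : ℝ :=
  ∑ i, D.w i s ω

/-- The sigma-field generated by the shares `W`. -/
def sigmaW (D : ShiftShare S N p Ω) : MeasurableSpace Ω :=
  ⨆ i, ⨆ s, MeasurableSpace.comap (D.w i s) inferInstance

/-- The sigma-field `F_0` generated by the sector-level controls, `U`, `Y(0)`, `B` and `W`. -/
def F0 (D : ShiftShare S N p Ω) : MeasurableSpace Ω :=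
  (⨆ s, ⨆ k, MeasurableSpace.comap (D.ZZ s k) inferInstance) ⊔
  (⨆ i, ⨆ k, MeasurableSpace.comap (D.U i k) inferInstance) ⊔
  (⨆ i, MeasurableSpace.comap (D.Y0 i) inferInstance) ⊔
  (⨆ i, ⨆ s, MeasurableSpace.comap (D.B i s) inferInstance) ⊔
  D.sigmaW

/-- `σ_s² = Var(X_s | F_0)`. -/
noncomputable def condVariance (D : ShiftShare S N p Ω) (P : Measure Ω) (s : Fin S) : Ω → ℝ :=
  Var[D.XX s; P | D.F0]

/-- Residuals `X - Z (Z'Z)⁻¹ Z'X` of the regression of the shift-share regressor on the controls. -/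
noncomputable def Xres (D : ShiftShare S N p Ω) (ω : Ω) : Fin N → ℝ :=
  D.X ω - D.Z ω *ᵥ (((D.Z ω)ᵀ * D.Z ω)⁻¹ *ᵥ ((D.Z ω)ᵀ *ᵥ D.X ω))

/-- OLS coefficient on the shift-share regressor in the regression of `Y` on `(X, Z)`. -/
noncomputable def betaHat (D : ShiftShare S N p Ω) (ω : Ω) : ℝ :=
  (D.Xres ω ⬝ᵥ D.Y ω) / (D.Xres ω ⬝ᵥ D.Xres ω)

/-- `∑_i ∑_s w_is² σ_s²`. -/
noncomputable def totalWeight (D : ShiftShare S N p Ω) (P : Measure Ω) (ω : Ω) : ℝ :=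
  ∑ i, ∑ s, D.w i s ω ^ 2 * D.condVariance P s ω

/-- The estimand `∑ w_is² σ_s² β_is / ∑ w_is² σ_s²`. -/
noncomputable def betaBar (D : ShiftShare S N p Ω) (P : Measure Ω) (ω : Ω) : ℝ :=
  (∑ i, ∑ s, D.w i s ω ^ 2 * D.condVariance P s ω * D.B i s ω) / D.totalWeight P ω

end ShiftShare

/-!
Conditionally on `F_0` the shares and the effects are constants and the shocks
`X_s - E[X_s | F_0]` are independent and centered. As `E[X_s | F_0] = Z_s'γ`, the regressor is
`Zγ` plus an innovation made of the share-weighted shocks and the negligible error `U_i'γ`, so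
partialling out `Z` leaves the residual of the innovation. Averages over regions of the innovation
against `F_0`-measurable variables are linear forms in the shocks and vanish by Chebyshev's
inequality, since `max_s n_s / N → 0`. Its averages against the outcome and against itself are
quadratic forms. Their off-diagonal parts vanish in the same way; the squares on the diagonal have
only `1 + ν / 2` moments and are truncated, which leaves the conditional variances
`∑_i ∑_s w_is² σ_s² b_is / N`. The conditional bounds on first absolute moments turn into bounds on
unconditional probabilities through the conditional Markov inequality.
-/

section HighProbability

variable {Ω : ℕ → Type*} [mΩ : ∀ S, MeasurableSpace (Ω S)] {P : ∀ S, Measure (Ω S)}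

/-- The events of the triangular array whose probability in the `S`-th row tends to one. An array of
random variables is a function on `Σ S, Ω S`, and convergence in probability is convergence along
this filter. -/
def highProb (P : ∀ S, Measure (Ω S)) : Filter (Σ S, Ω S) where
  sets := {E | Tendsto (fun S => P S {ω | ⟨S, ω⟩ ∉ E}) atTop (𝓝 0)}
  univ_sets := by simp
  sets_of_superset hE hEF := tendsto_of_tendsto_of_tendsto_of_le_of_le tendsto_const_nhds hE
    (fun _ => zero_le) fun _ => measure_mono fun _ hω h => hω (hEF h)
  inter_sets {E F} hE hF := by
    refine tendsto_of_tendsto_of_tendsto_of_le_of_le tendsto_const_nhds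
      (by simpa using hE.add hF) (fun _ => zero_le) fun S => ?_
    refine (measure_mono fun ω hω => ?_).trans (measure_union_le _ _)
    exact not_and_or.1 hω

theorem eventually_highProb {p : (Σ S, Ω S) → Prop} :
    (∀ᶠ x in highProb P, p x) ↔ Tendsto (fun S => P S {ω | ¬ p ⟨S, ω⟩}) atTop (𝓝 0) :=
  Iff.rfl

theorem eventually_highProb_of_ae {p : (Σ S, Ω S) → Prop} (h : ∀ S, ∀ᵐ ω ∂P S, p ⟨S, ω⟩) :
    ∀ᶠ x in highProb P, p x :=
  eventually_highProb.2 <| by simp only [fun S => ae_iff.1 (h S), tendsto_const_nhds]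

theorem tendsto_fst_highProb : Tendsto Sigma.fst (highProb P) atTop := by
  refine tendsto_atTop.2 fun S₀ => eventually_highProb.2 <| tendsto_const_nhds.congr' ?_
  filter_upwards [eventually_ge_atTop S₀] with S hS
  simp [hS]

theorem convInProb_iff_tendsto_highProb {A : ∀ S, Ω S → ℝ} {a : ℝ} :
    ConvInProb P A a ↔ Tendsto (fun x => A x.1 x.2) (highProb P) (𝓝 a) := by
  simp only [Metric.tendsto_nhds, eventually_highProb, Real.dist_eq, not_lt, ConvInProb, gt_iff_lt]

/-- Boundedness in probability (uniform tightness) of a triangular array of random variables. -/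
def BddInProb (P : ∀ S, Measure (Ω S)) (A : (Σ S, Ω S) → ℝ) : Prop :=
  ∀ ε : ENNReal, 0 < ε → ∃ K : ℝ, ∀ᶠ S in atTop, P S {ω | K < |A ⟨S, ω⟩|} ≤ ε

theorem BddInProb.of_tendsto {A : (Σ S, Ω S) → ℝ} {a : ℝ} (hA : Tendsto A (highProb P) (𝓝 a)) :
    BddInProb P A := fun ε hε => by
  refine ⟨|a| + 1, ?_⟩
  have h := eventually_highProb.1 (hA.abs.eventually_le_const (lt_add_one |a|))
  simpa only [not_le] using h.eventually_le_const hε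

theorem BddInProb.add {A B : (Σ S, Ω S) → ℝ} (hA : BddInProb P A) (hB : BddInProb P B) :
    BddInProb P (A + B) := fun ε hε => by
  obtain ⟨K, hK⟩ := hA (ε / 2) (ENNReal.half_pos hε.ne')
  obtain ⟨L, hL⟩ := hB (ε / 2) (ENNReal.half_pos hε.ne')
  refine ⟨K + L, ?_⟩
  filter_upwards [hK, hL] with S hK hL
  refine (measure_mono fun ω hω => ?_).trans <| (measure_union_le _ _).trans <|
    (add_le_add hK hL).trans_eq (ENNReal.add_halves ε)
  contrapose! hω
  simp only [Set.mem_union, Set.mem_ofPred_eq, not_or, not_lt] at hω ⊢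
  exact (abs_add_le _ _).trans (add_le_add hω.1 hω.2)

theorem measure_le_abs_le_ofReal_integral_div {Ω : Type*} [MeasurableSpace Ω] {μ : Measure Ω}
    [IsFiniteMeasure μ] {f : Ω → ℝ} (hf : Integrable f μ) {ε : ℝ} (hε : 0 < ε) :
    μ {ω | ε ≤ |f ω|} ≤ ENNReal.ofReal ((∫ ω, |f ω| ∂μ) / ε) := by
  rw [← ofReal_measureReal]
  refine ENNReal.ofReal_le_ofReal ((le_div_iff₀' hε).2 ?_)
  exact mul_meas_ge_le_integral_of_nonneg (ae_of_all _ fun _ => abs_nonneg _) hf.abs ε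

theorem BddInProb.of_integral_abs_le [∀ S, IsFiniteMeasure (P S)] {A : (Σ S, Ω S) → ℝ} {C : ℝ}
    (h_int : ∀ S, Integrable (fun ω => A ⟨S, ω⟩) (P S)) (hC : ∀ S, ∫ ω, |A ⟨S, ω⟩| ∂P S ≤ C) :
    BddInProb P A := fun ε hε => by
  have h_lim : Tendsto (fun K : ℝ => ENNReal.ofReal (C / K)) atTop (𝓝 0) := by
    simpa using ENNReal.tendsto_ofReal ((tendsto_const_nhds (x := C)).div_atTop tendsto_id)
  obtain ⟨K, hK, hK₀⟩ := ((h_lim.eventually_le_const hε).and (eventually_gt_atTop 0)).exists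
  refine ⟨K, Eventually.of_forall fun S => ?_⟩
  calc P S {ω | K < |A ⟨S, ω⟩|} ≤ P S {ω | K ≤ |A ⟨S, ω⟩|} :=
        measure_mono <| Set.ofPred_subset_ofPred.2 fun _ => le_of_lt
    _ ≤ ENNReal.ofReal ((∫ ω, |A ⟨S, ω⟩| ∂P S) / K) :=
      measure_le_abs_le_ofReal_integral_div (h_int S) hK₀
    _ ≤ ε := (ENNReal.ofReal_le_ofReal (by gcongr; exact hC S)).trans hK

theorem BddInProb.tendsto_mul_zero {A B : (Σ S, Ω S) → ℝ} (hB : BddInProb P B)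
    (hA : Tendsto A (highProb P) (𝓝 0)) : Tendsto (fun x => A x * B x) (highProb P) (𝓝 0) := by
  refine Metric.tendsto_nhds.2 fun δ hδ => eventually_highProb.2 <|
    ENNReal.tendsto_nhds_zero.2 fun ε hε => ?_
  obtain ⟨K, hK⟩ := hB (ε / 2) (ENNReal.half_pos hε.ne')
  have h_small := eventually_highProb.1
    ((tendsto_zero_iff_abs_tendsto_zero _).1 hA |>.eventually_lt_const
      (show 0 < δ / (|K| + 1) by positivity))
  filter_upwards [hK, ENNReal.tendsto_nhds_zero.1 h_small _ (ENNReal.half_pos hε.ne')]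
    with S hK h_small
  refine (measure_mono fun ω hω => ?_).trans <| (measure_union_le _ _).trans <|
    (add_le_add h_small hK).trans_eq (ENNReal.add_halves ε)
  contrapose! hω
  simp only [Set.mem_union, Set.mem_ofPred_eq, not_or, not_le, not_lt, Function.comp_apply]
    at hω ⊢
  rw [dist_zero_right, Real.norm_eq_abs, abs_mul]
  calc |A ⟨S, ω⟩| * |B ⟨S, ω⟩| ≤ |A ⟨S, ω⟩| * (|K| + 1) := by
        gcongr; linarith [le_abs_self K]
    _ < δ := (lt_div_iff₀ (by positivity)).1 hω.1

end HighProbability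

section ConditionalMarkov

theorem measure_le_abs_le_of_condExp_abs_le {Ω : Type*} {m : MeasurableSpace Ω}
    [mΩ : MeasurableSpace Ω] {P : Measure Ω} [IsProbabilityMeasure P] (hm : m ≤ mΩ) {f : Ω → ℝ}
    (hf : Integrable f P) {ε η : ℝ} (hε : 0 < ε) (hη : 0 ≤ η) :
    P {ω | ε ≤ |f ω|} ≤
      P {ω | ¬ (P[fun ω => |f ω| | m]) ω ≤ η} + ENNReal.ofReal (η / ε) := by
  set E : Set Ω := {ω | (P[fun ω => |f ω| | m]) ω ≤ η}
  have hE_meas : MeasurableSet[m] E :=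
    measurableSet_le stronglyMeasurable_condExp.measurable measurable_const
  have h_mean : ∫ ω in E, |f ω| ∂P ≤ η := by
    rw [← setIntegral_condExp hm hf.abs hE_meas]
    refine (setIntegral_mono_on integrable_condExp.integrableOn (integrable_const η).integrableOn
      (hm _ hE_meas) fun _ hω => hω).trans ?_
    rw [setIntegral_const, smul_eq_mul]
    exact mul_le_of_le_one_left hη measureReal_le_one
  calc P {ω | ε ≤ |f ω|} ≤ P (Eᶜ ∪ {ω | ε ≤ |f ω|} ∩ E) := measure_mono fun ω hω => by
        by_cases h : ω ∈ E
        · exact .inr ⟨hω, h⟩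
        · exact .inl h
    _ ≤ P Eᶜ + P.restrict E {ω | ε ≤ |f ω|} := by
        rw [Measure.restrict_apply' (hm _ hE_meas)]
        exact measure_union_le _ _
    _ ≤ P Eᶜ + ENNReal.ofReal (η / ε) := by
        gcongr
        exact (measure_le_abs_le_ofReal_integral_div hf.restrict hε).trans
          (ENNReal.ofReal_le_ofReal (by gcongr))

variable {Ω : ℕ → Type*} {m : ∀ S, MeasurableSpace (Ω S)} [mΩ : ∀ S, MeasurableSpace (Ω S)]
  {P : ∀ S, Measure (Ω S)} [∀ S, IsProbabilityMeasure (P S)] {A : (Σ S, Ω S) → ℝ}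

theorem tendsto_highProb_zero_of_condExp_abs (hm : ∀ S, m S ≤ mΩ S)
    (h_int : ∀ S, Integrable (fun ω => A ⟨S, ω⟩) (P S))
    (h : ∀ η > 0, ∀ᶠ x in highProb P,
      ((P x.1)[fun ω => |A ⟨x.1, ω⟩| | m x.1]) x.2 ≤ η) :
    Tendsto A (highProb P) (𝓝 0) := by
  refine Metric.tendsto_nhds.2 fun ε hε => eventually_highProb.2 <|
    ENNReal.tendsto_nhds_zero.2 fun δ hδ => ?_
  have h_lim : Tendsto (fun η : ℝ => ENNReal.ofReal (η / ε)) (𝓝[>] 0) (𝓝 0) := by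
    have h : Tendsto (fun η : ℝ => η / ε) (𝓝[>] 0) (𝓝 (0 / ε)) :=
      ((continuous_id.div_const ε).tendsto 0).mono_left nhdsWithin_le_nhds
    simpa using ENNReal.tendsto_ofReal h
  obtain ⟨η, hη, hη₀⟩ := ((h_lim.eventually_le_const (ENNReal.half_pos hδ.ne')).and
    self_mem_nhdsWithin).exists
  filter_upwards [(eventually_highProb.1 (h η hη₀)).eventually_le_const
    (ENNReal.half_pos hδ.ne')] with S hS
  simp only [dist_zero_right, Real.norm_eq_abs, not_lt]
  exact (measure_le_abs_le_of_condExp_abs_le (hm S) (h_int S) hε (le_of_lt hη₀)).trans <|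
    (add_le_add hS hη).trans_eq (ENNReal.add_halves δ)

theorem tendsto_highProb_zero_of_integral_abs
    (h_int : ∀ S, Integrable (fun ω => A ⟨S, ω⟩) (P S))
    (h : Tendsto (fun S => ∫ ω, |A ⟨S, ω⟩| ∂P S) atTop (𝓝 0)) :
    Tendsto A (highProb P) (𝓝 0) := by
  refine tendsto_highProb_zero_of_condExp_abs (m := fun _ => ⊥) (fun _ => bot_le) h_int
    fun η hη => ?_
  simp only [condExp_bot]
  exact tendsto_fst_highProb.eventually (h.eventually_le_const hη)

end ConditionalMarkov

theorem sum_sum_eq_diag_add_lt_add_lt {ι R : Type*} [Fintype ι] [LinearOrder ι]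
    [AddCommMonoid R] (f : ι → ι → R) :
    ∑ s, ∑ t, f s t = ∑ s, f s s + (∑ x : ι × ι with x.1 < x.2, f x.1 x.2 +
      ∑ x : ι × ι with x.1 < x.2, f x.2 x.1) := by
  have h_cases : ∀ s t, f s t =
      (if s = t then f s t else 0) + ((if s < t then f s t else 0) + if t < s then f s t else 0) :=
    fun s t => by
      rcases lt_trichotomy s t with h | h | h 
      exacts [by simp [h, h.not_gt, h.ne], by simp [h], by simp [h, h.not_gt, h.ne']]
  have h_lower : ∑ s, ∑ t, (if t < s then f s t else 0) =
      ∑ s, ∑ t, if s < t then f t s else 0 := Finset.sum_comm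
  simp_rw [Finset.sum_filter, Fintype.sum_prod_type, ← h_lower]
  rw [Finset.sum_congr rfl fun s _ => Finset.sum_congr rfl fun t _ => h_cases s t]
  simp only [Finset.sum_add_distrib, Finset.sum_ite_eq, Finset.mem_univ, if_true]

section IndependentFamilies

variable {Ω ι : Type*} [MeasurableSpace Ω] {μ : Measure Ω}

theorem integral_abs_mul_le_sqrt_mul_sqrt {f g : Ω → ℝ} (hf : MemLp f 2 μ) (hg : MemLp g 2 μ) :
    ∫ ω, |f ω * g ω| ∂μ ≤ √(∫ ω, f ω ^ 2 ∂μ) * √(∫ ω, g ω ^ 2 ∂μ) := by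
  have h := integral_mul_norm_le_Lp_mul_Lq Real.HolderConjugate.two_two
    (by simpa using hf) (by simpa using hg)
  simpa [abs_mul, Real.sqrt_eq_rpow] using h

theorem integral_abs_le_sqrt_integral_sq [IsProbabilityMeasure μ] {f : Ω → ℝ}
    (hf : MemLp f 2 μ) : ∫ ω, |f ω| ∂μ ≤ √(∫ ω, f ω ^ 2 ∂μ) := by
  simpa using integral_abs_mul_le_sqrt_mul_sqrt hf (memLp_const (1 : ℝ))

theorem integral_sq_sum_of_orthogonal (T : Finset ι) {Y : ι → Ω → ℝ}
    (hY : ∀ a ∈ T, MemLp (Y a) 2 μ)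
    (h_orth : ∀ a ∈ T, ∀ b ∈ T, a ≠ b → ∫ ω, Y a ω * Y b ω ∂μ = 0) :
    ∫ ω, (∑ a ∈ T, Y a ω) ^ 2 ∂μ = ∑ a ∈ T, ∫ ω, Y a ω ^ 2 ∂μ := by
  have h_int : ∀ a ∈ T, ∀ b ∈ T, Integrable (fun ω => Y a ω * Y b ω) μ := fun a ha b hb =>
    (hY a ha).integrable_mul (hY b hb)
  simp_rw [sq, Finset.sum_mul_sum]
  rw [integral_finsetSum _ fun a ha => integrable_finsetSum _ (h_int a ha)]
  refine Finset.sum_congr rfl fun a ha => ?_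
  rw [integral_finsetSum _ (h_int a ha)]
  exact Finset.sum_eq_single_of_mem a ha fun b hb hba => h_orth a ha b hb hba.symm

theorem integral_abs_sum_mul_sub_integral_le_sqrt [Fintype ι] [IsProbabilityMeasure μ]
    {η : ι → Ω → ℝ} (h_ind : Pairwise fun s t => IndepFun (η s) (η t) μ)
    (hη : ∀ s, MemLp (η s) 2 μ) (c : ι → ℝ) :
    ∫ ω, |∑ s, c s * (η s ω - ∫ ω', η s ω' ∂μ)| ∂μ ≤ √(∑ s, c s ^ 2 * Var[η s; μ]) := by
  have h_mem : ∀ s ∈ Finset.univ, MemLp (fun ω => c s * (η s ω - ∫ ω', η s ω' ∂μ)) 2 μ :=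
    fun s _ => ((hη s).sub (memLp_const _)).const_mul _
  refine (integral_abs_le_sqrt_integral_sq (memLp_finsetSum _ h_mem)).trans_eq ?_
  congr 1
  rw [integral_sq_sum_of_orthogonal _ h_mem]
  · simp_rw [mul_pow, integral_const_mul, variance_eq_integral (hη _).aemeasurable]
  · intro s _ t _ hst
    simp_rw [mul_mul_mul_comm (c s), integral_const_mul]
    exact mul_eq_zero_of_right _ ((h_ind hst).covariance_eq_zero (hη s) (hη t))

theorem integral_abs_add_le_add_integral_abs {f g : Ω → ℝ} (hf : Integrable f μ)
    (hg : Integrable g μ) :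
    ∫ ω, |f ω + g ω| ∂μ ≤ (∫ ω, |f ω| ∂μ) + ∫ ω, |g ω| ∂μ := by
  rw [← integral_add hf.abs hg.abs]
  exact integral_mono (hf.add hg).abs (hf.abs.add hg.abs) fun ω => abs_add_le _ _

theorem integral_abs_sub_integral_le [IsProbabilityMeasure μ] {f : Ω → ℝ}
    (hf : Integrable f μ) : ∫ ω, |f ω - ∫ ω', f ω' ∂μ| ∂μ ≤ 2 * ∫ ω, |f ω| ∂μ := by
  have h := integral_abs_add_le_add_integral_abs hf (integrable_const (-∫ ω, f ω ∂μ))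
  simp only [← sub_eq_add_neg, abs_neg, integral_const, probReal_univ, one_smul] at h
  linarith [abs_integral_le_integral_abs (f := f) (μ := μ)]

theorem integral_abs_sum_mul_sub_integral_le_sum [Fintype ι] [IsProbabilityMeasure μ]
    {η : ι → Ω → ℝ} (hη : ∀ s, Integrable (η s) μ) (d : ι → ℝ) :
    ∫ ω, |∑ s, d s * (η s ω - ∫ ω', η s ω' ∂μ)| ∂μ ≤ 2 * ∑ s, |d s| * ∫ ω, |η s ω| ∂μ := by
  have h_int : ∀ s, Integrable (fun ω => η s ω - ∫ ω', η s ω' ∂μ) μ := fun s =>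
    (hη s).sub (integrable_const _)
  calc ∫ ω, |∑ s, d s * (η s ω - ∫ ω', η s ω' ∂μ)| ∂μ
      ≤ ∫ ω, ∑ s, |d s| * |η s ω - ∫ ω', η s ω' ∂μ| ∂μ := by
        refine integral_mono (integrable_finsetSum _ fun s _ => (h_int s).const_mul _).abs
          (integrable_finsetSum _ fun s _ => (h_int s).abs.const_mul _) fun ω => ?_
        simpa only [abs_mul] using Finset.abs_sum_le_sum_abs (fun s => d s * _) Finset.univ
    _ = ∑ s, |d s| * ∫ ω, |η s ω - ∫ ω', η s ω' ∂μ| ∂μ := by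
        rw [integral_finsetSum _ fun s _ => (h_int s).abs.const_mul _]
        simp_rw [integral_const_mul]
    _ ≤ 2 * ∑ s, |d s| * ∫ ω, |η s ω| ∂μ := by
        rw [Finset.mul_sum]
        refine Finset.sum_le_sum fun s _ => ?_
        rw [mul_left_comm]
        exact mul_le_mul_of_nonneg_left (integral_abs_sub_integral_le (hη s)) (abs_nonneg _)

theorem integral_abs_sum_mul_sub_integral_le_of_mem_Icc [Fintype ι] [IsProbabilityMeasure μ]
    {η : ι → Ω → ℝ} (h_ind : Pairwise fun s t => IndepFun (η s) (η t) μ)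
    (hη : ∀ s, AEStronglyMeasurable (η s) μ) {B : ℝ} (hB : 0 ≤ B)
    (h_mem : ∀ s, ∀ᵐ ω ∂μ, η s ω ∈ Set.Icc 0 B) (d : ι → ℝ) :
    ∫ ω, |∑ s, d s * (η s ω - ∫ ω', η s ω' ∂μ)| ∂μ ≤ B * √(∑ s, d s ^ 2) := by
  refine (integral_abs_sum_mul_sub_integral_le_sqrt h_ind
    (fun s => memLp_of_bounded (h_mem s) (hη s) 2) d).trans ?_
  rw [Real.sqrt_le_left (by positivity), mul_pow, Real.sq_sqrt (by positivity), mul_comm,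
    Finset.sum_mul]
  gcongr with s
  refine (variance_le_sq_of_bounded (h_mem s) (hη s).aemeasurable).trans ?_
  nlinarith

-- Truncating at `B` leaves a bounded part, of variance at most `B ^ 2`, and a small excess.
theorem integral_abs_sum_mul_sub_integral_le_of_excess_le [Fintype ι] [IsProbabilityMeasure μ]
    {η : ι → Ω → ℝ} (h_ind : Pairwise fun s t => IndepFun (η s) (η t) μ)
    (hη : ∀ s, Integrable (η s) μ) (h_nonneg : ∀ s ω, 0 ≤ η s ω) {B τ : ℝ} (hB : 0 ≤ B)
    (hτ : ∀ s, ∫ ω, max (η s ω - B) 0 ∂μ ≤ τ) (d : ι → ℝ) :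
    ∫ ω, |∑ s, d s * (η s ω - ∫ ω', η s ω' ∂μ)| ∂μ ≤
      B * √(∑ s, d s ^ 2) + 2 * (τ * ∑ s, |d s|) := by
  let low : ι → Ω → ℝ := fun s ω => min (η s ω) B
  let exc : ι → Ω → ℝ := fun s ω => max (η s ω - B) 0
  have h_low_bdd : ∀ s, ∀ᵐ ω ∂μ, low s ω ∈ Set.Icc 0 B := fun s =>
    ae_of_all _ fun ω => ⟨le_min (h_nonneg s ω) hB, min_le_right _ _⟩
  have h_low : ∀ s, MemLp (low s) 2 μ := fun s =>
    memLp_of_bounded (h_low_bdd s) ((hη s).1.inf aestronglyMeasurable_const) 2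
  have h_exc : ∀ s, Integrable (exc s) μ := fun s => ((hη s).sub (integrable_const B)).pos_part
  have h_split : ∀ s ω, η s ω = low s ω + exc s ω := fun s ω => by
    simp only [low, exc]
    rcases le_total (η s ω) B with h | h <;> simp [h]
  have h_low_sum : ∫ ω, |∑ s, d s * (low s ω - ∫ ω', low s ω' ∂μ)| ∂μ ≤ B * √(∑ s, d s ^ 2) :=
    integral_abs_sum_mul_sub_integral_le_of_mem_Icc (fun s t hst => (h_ind hst).comp
      (φ := fun x => min x B) (ψ := fun x => min x B) (by fun_prop) (by fun_prop))
      (fun s => (h_low s).1) hB h_low_bdd d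
  have h_exc_sum : ∫ ω, |∑ s, d s * (exc s ω - ∫ ω', exc s ω' ∂μ)| ∂μ ≤
      2 * (τ * ∑ s, |d s|) := by
    refine (integral_abs_sum_mul_sub_integral_le_sum h_exc d).trans ?_
    rw [Finset.mul_sum _ _ τ]
    gcongr 2 * ?_
    refine Finset.sum_le_sum fun s _ => ?_
    rw [mul_comm]
    gcongr
    simpa only [exc, abs_of_nonneg (le_max_right _ (0 : ℝ))] using hτ s
  have h_center : ∀ s ω, η s ω - ∫ ω', η s ω' ∂μ =
      (low s ω - ∫ ω', low s ω' ∂μ) + (exc s ω - ∫ ω', exc s ω' ∂μ) := fun s ω => by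
    simp_rw [h_split s]
    rw [integral_add ((h_low s).integrable one_le_two) (h_exc s)]
    ring
  have h_low_int : Integrable (fun ω => ∑ s, d s * (low s ω - ∫ ω', low s ω' ∂μ)) μ :=
    integrable_finsetSum _ fun s _ =>
      (((h_low s).integrable one_le_two).sub (integrable_const _)).const_mul _
  have h_exc_int : Integrable (fun ω => ∑ s, d s * (exc s ω - ∫ ω', exc s ω' ∂μ)) μ :=
    integrable_finsetSum _ fun s _ => ((h_exc s).sub (integrable_const _)).const_mul _
  simp_rw [h_center, mul_add, Finset.sum_add_distrib]
  exact (integral_abs_add_le_add_integral_abs h_low_int h_exc_int).trans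
    (add_le_add h_low_sum h_exc_sum)

theorem integral_mul_mul_mul_eq_zero [Finite ι] [LinearOrder ι] {ξ : ι → Ω → ℝ}
    (h_ind : iIndepFun ξ μ) (hξ : ∀ s, MemLp (ξ s) 2 μ) (h_mean : ∀ s, ∫ ω, ξ s ω ∂μ = 0)
    {s t s' t' : ι} (hst : s < t) (hst' : s' < t') (hne : (s, t) ≠ (s', t')) :
    ∫ ω, ξ s ω * ξ t ω * (ξ s' ω * ξ t' ω) ∂μ = 0 := by
  have := Fintype.ofFinite ι
  let mult : ι → ℕ := fun r => (if s = r then 1 else 0) + (if t = r then 1 else 0) +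
    ((if s' = r then 1 else 0) + (if t' = r then 1 else 0))
  have h_prod : ∀ ω, ξ s ω * ξ t ω * (ξ s' ω * ξ t' ω) = ∏ r, ξ r ω ^ mult r := fun ω => by
    simp only [mult, pow_add, Finset.prod_mul_distrib, Finset.prod_pow_boole, Finset.mem_univ,
      if_true]
  obtain ⟨r, hr⟩ : ∃ r, mult r = 1 := by
    by_cases hs : s' = s ∨ t' = s
    · by_cases ht : s' = t ∨ t' = t
      · grind
      · push Not at ht
        exact ⟨t, by simp [mult, hst.ne, ht.1, ht.2]⟩
    · push Not at hs
      exact ⟨s, by simp [mult, hst.ne', hs.1, hs.2]⟩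
  simp_rw [h_prod]
  rw [h_ind.integral_fun_prod_comp (f := fun r x => x ^ mult r)
    (fun r => (hξ r).1.aemeasurable) (fun r => by fun_prop)]
  exact Finset.prod_eq_zero (Finset.mem_univ r) (by simpa [hr] using h_mean r)

theorem memLp_two_mul_of_indepFun {f g : Ω → ℝ} (h_ind : IndepFun f g μ) (hf : MemLp f 2 μ)
    (hg : MemLp g 2 μ) : MemLp (fun ω => f ω * g ω) 2 μ := by
  refine (memLp_two_iff_integrable_sq (f := fun ω => f ω * g ω) (hf.1.mul hg.1)).2 ?_
  have h_sq : IndepFun (fun ω => f ω ^ 2) (fun ω => g ω ^ 2) μ :=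
    h_ind.comp (φ := (· ^ 2)) (ψ := (· ^ 2)) (by fun_prop) (by fun_prop)
  simp_rw [mul_pow]
  exact h_sq.integrable_mul hf.integrable_sq hg.integrable_sq

theorem integral_sq_mul_of_indepFun {f g : Ω → ℝ} (h_ind : IndepFun f g μ) (hf : MemLp f 2 μ)
    (hg : MemLp g 2 μ) :
    ∫ ω, (f ω * g ω) ^ 2 ∂μ = (∫ ω, f ω ^ 2 ∂μ) * ∫ ω, g ω ^ 2 ∂μ := by
  have h_sq : IndepFun (fun ω => f ω ^ 2) (fun ω => g ω ^ 2) μ :=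
    h_ind.comp (φ := (· ^ 2)) (ψ := (· ^ 2)) (by fun_prop) (by fun_prop)
  simp_rw [mul_pow]
  exact h_sq.integral_fun_mul_eq_mul_integral hf.integrable_sq.1 hg.integrable_sq.1

variable [Fintype ι] [LinearOrder ι] [IsProbabilityMeasure μ] {ξ : ι → Ω → ℝ} {K : ℝ}

theorem integral_abs_sum_lt_le (h_ind : iIndepFun ξ μ) (hξ : ∀ s, MemLp (ξ s) 2 μ)
    (h_mean : ∀ s, ∫ ω, ξ s ω ∂μ = 0) (hK₀ : 0 ≤ K) (hK : ∀ s, ∫ ω, ξ s ω ^ 2 ∂μ ≤ K)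
    (M : ι → ι → ℝ) :
    ∫ ω, |∑ x : ι × ι with x.1 < x.2, M x.1 x.2 * (ξ x.1 ω * ξ x.2 ω)| ∂μ ≤
      K * √(∑ s, ∑ t, M s t ^ 2) := by
  have h_mem : ∀ x ∈ Finset.univ.filter fun x : ι × ι => x.1 < x.2,
      MemLp (fun ω => M x.1 x.2 * (ξ x.1 ω * ξ x.2 ω)) 2 μ := fun x hx =>
    (memLp_two_mul_of_indepFun (h_ind.indepFun (Finset.mem_filter.1 hx).2.ne)
      (hξ _) (hξ _)).const_mul _
  refine (integral_abs_le_sqrt_integral_sq (memLp_finsetSum _ h_mem)).trans ?_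
  rw [Real.sqrt_le_left (by positivity), mul_pow, Real.sq_sqrt (by positivity),
    integral_sq_sum_of_orthogonal _ h_mem, ← Fintype.sum_prod_type' fun s t => M s t ^ 2,
    Finset.mul_sum]
  · refine (Finset.sum_le_sum fun x hx => ?_).trans
      (Finset.sum_le_sum_of_subset_of_nonneg (Finset.filter_subset _ _) fun _ _ _ => by positivity)
    simp_rw [mul_pow (M x.1 x.2), integral_const_mul]
    rw [integral_sq_mul_of_indepFun (h_ind.indepFun (Finset.mem_filter.1 hx).2.ne)
      (hξ _) (hξ _), mul_comm, sq K]
    gcongr <;> exact hK _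
  · intro x hx y hy hxy
    simp_rw [mul_mul_mul_comm (M x.1 x.2), integral_const_mul]
    rw [integral_mul_mul_mul_eq_zero h_ind hξ h_mean (Finset.mem_filter.1 hx).2
      (Finset.mem_filter.1 hy).2 hxy, mul_zero]

theorem integral_abs_quadratic_sub_diag_le (h_ind : iIndepFun ξ μ) (hξ : ∀ s, MemLp (ξ s) 2 μ)
    (h_mean : ∀ s, ∫ ω, ξ s ω ∂μ = 0) (hK₀ : 0 ≤ K) (hK : ∀ s, ∫ ω, ξ s ω ^ 2 ∂μ ≤ K)
    {B τ : ℝ} (hB : 0 ≤ B) (hτ : ∀ s, ∫ ω, max (ξ s ω ^ 2 - B) 0 ∂μ ≤ τ) (M : ι → ι → ℝ) :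
    ∫ ω, |∑ s, ∑ t, M s t * (ξ s ω * ξ t ω) - ∑ s, M s s * ∫ ω', ξ s ω' ^ 2 ∂μ| ∂μ ≤
      (2 * K + B) * √(∑ s, ∑ t, M s t ^ 2) + 2 * (τ * ∑ s, |M s s|) := by
  let diag : Ω → ℝ := fun ω => ∑ s, M s s * (ξ s ω ^ 2 - ∫ ω', ξ s ω' ^ 2 ∂μ)
  let upper (M : ι → ι → ℝ) : Ω → ℝ := fun ω =>
    ∑ x : ι × ι with x.1 < x.2, M x.1 x.2 * (ξ x.1 ω * ξ x.2 ω)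
  have h_split : ∀ ω, ∑ s, ∑ t, M s t * (ξ s ω * ξ t ω) - ∑ s, M s s * ∫ ω', ξ s ω' ^ 2 ∂μ =
      diag ω + (upper M ω + upper (fun s t => M t s) ω) := fun ω => by
    simp only [sum_sum_eq_diag_add_lt_add_lt, diag, upper, mul_sub, Finset.sum_sub_distrib, sq,
      mul_comm (ξ (Prod.snd _) ω)]
    ring
  have h_diag : Integrable diag μ := integrable_finsetSum _ fun s _ =>
    ((hξ s).integrable_sq.sub (integrable_const _)).const_mul _
  have h_upper : ∀ M, Integrable (upper M) μ := fun M => integrable_finsetSum _ fun x _ =>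
    ((hξ x.1).integrable_mul (hξ x.2)).const_mul _
  have h_diag_le : ∫ ω, |diag ω| ∂μ ≤
      B * √(∑ s, ∑ t, M s t ^ 2) + 2 * (τ * ∑ s, |M s s|) := by
    refine (integral_abs_sum_mul_sub_integral_le_of_excess_le
      (fun s t hst => (h_ind.indepFun hst).comp (φ := (· ^ 2)) (ψ := (· ^ 2)) (by fun_prop)
        (by fun_prop)) (fun s => (hξ s).integrable_sq) (fun _ _ => sq_nonneg _) hB hτ _).trans ?_
    gcongr with s
    exact Finset.single_le_sum (f := fun t => M s t ^ 2) (fun _ _ => sq_nonneg _)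
      (Finset.mem_univ s)
  have h_upper_le : ∀ M, ∫ ω, |upper M ω| ∂μ ≤ K * √(∑ s, ∑ t, M s t ^ 2) :=
    integral_abs_sum_lt_le h_ind hξ h_mean hK₀ hK
  have h_lower_le : ∫ ω, |upper (fun s t => M t s) ω| ∂μ ≤ K * √(∑ s, ∑ t, M s t ^ 2) := by
    rw [Finset.sum_comm]
    exact h_upper_le fun s t => M t s
  simp_rw [h_split]
  refine (integral_abs_add_le_add_integral_abs h_diag
    ((h_upper M).add (h_upper fun s t => M t s))).trans ?_
  have h_off_le := integral_abs_add_le_add_integral_abs (h_upper M) (h_upper fun s t => M t s)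
  simp only [Pi.add_apply]
  linarith [h_upper_le M]

end IndependentFamilies

section Moments

variable {Ω ι : Type*} [MeasurableSpace Ω] {μ : Measure Ω} {ν C : ℝ}

theorem sq_le_one_add_abs_rpow (hν : 0 ≤ ν) (x : ℝ) : x ^ 2 ≤ 1 + |x| ^ (2 + ν) := by
  rcases le_total |x| 1 with h | h
  · exact (sq_le_one_iff_abs_le_one x).2 h |>.trans (le_add_of_nonneg_right (by positivity))
  · rw [← sq_abs, ← Real.rpow_two]
    linarith [Real.rpow_le_rpow_of_exponent_le h (show (2 : ℝ) ≤ 2 + ν by linarith)]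

theorem max_sq_sub_sq_zero_le {R : ℝ} (hR : 0 < R) (hν : 0 ≤ ν) (x : ℝ) :
    max (x ^ 2 - R ^ 2) 0 ≤ |x| ^ (2 + ν) / R ^ ν := by
  refine max_le ?_ (by positivity)
  rw [le_div_iff₀ (by positivity), ← sq_abs]
  rcases le_total |x| R with h | h
  · refine (mul_nonpos_of_nonpos_of_nonneg (sub_nonpos.2 ?_) (by positivity)).trans (by positivity)
    gcongr
  · rw [Real.rpow_add (hR.trans_le h), Real.rpow_two]
    gcongr
    linarith [sq_nonneg R]

theorem memLp_two_of_integrable_abs_rpow [IsFiniteMeasure μ] {f : Ω → ℝ}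
    (hf : AEStronglyMeasurable f μ) (hν : 0 ≤ ν)
    (h_int : Integrable (fun ω => |f ω| ^ (2 + ν)) μ) : MemLp f 2 μ := by
  refine (memLp_two_iff_integrable_sq hf).2 <|
    ((integrable_const 1).add h_int).mono' (hf.pow 2) (ae_of_all _ fun ω => ?_)
  rw [Real.norm_of_nonneg (sq_nonneg _)]
  exact sq_le_one_add_abs_rpow hν _

variable [IsProbabilityMeasure μ]

theorem integral_sq_le_of_integral_abs_rpow_le {f : Ω → ℝ} (hf : AEStronglyMeasurable f μ)
    (hν : 0 ≤ ν) (h_int : Integrable (fun ω => |f ω| ^ (2 + ν)) μ)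
    (hC : ∫ ω, |f ω| ^ (2 + ν) ∂μ ≤ C) : ∫ ω, f ω ^ 2 ∂μ ≤ 1 + C := by
  calc ∫ ω, f ω ^ 2 ∂μ ≤ ∫ ω, (1 + |f ω| ^ (2 + ν)) ∂μ :=
        integral_mono (memLp_two_of_integrable_abs_rpow hf hν h_int).integrable_sq
          ((integrable_const _).add h_int) fun ω => sq_le_one_add_abs_rpow hν _
    _ = 1 + ∫ ω, |f ω| ^ (2 + ν) ∂μ := by simp [integral_add (integrable_const _) h_int]
    _ ≤ 1 + C := by gcongr

theorem abs_sub_rpow_le {q : ℝ} (hq : 1 ≤ q) (x y : ℝ) :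
    |x - y| ^ q ≤ 2 ^ (q - 1) * (|x| ^ q + |y| ^ q) := by
  refine (Real.rpow_le_rpow (abs_nonneg _) (abs_sub x y) (by linarith)).trans ?_
  exact_mod_cast NNReal.rpow_add_le_mul_rpow_add_rpow ‖x‖₊ ‖y‖₊ hq

theorem integral_abs_sub_integral_rpow_le {q : ℝ} (hq : 1 ≤ q) {f : Ω → ℝ}
    (hf : Integrable f μ) (h_int : Integrable (fun ω => |f ω| ^ q) μ) :
    Integrable (fun ω => |f ω - ∫ ω', f ω' ∂μ| ^ q) μ ∧
      ∫ ω, |f ω - ∫ ω', f ω' ∂μ| ^ q ∂μ ≤ 2 ^ q * ∫ ω, |f ω| ^ q ∂μ := by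
  have hq₀ : 0 ≤ q := zero_le_one.trans hq
  have h_mean : |∫ ω, f ω ∂μ| ^ q ≤ ∫ ω, |f ω| ^ q ∂μ :=
    (Real.rpow_le_rpow (abs_nonneg _) abs_integral_le_integral_abs hq₀).trans <|
      (convexOn_rpow hq).map_integral_le (Real.continuous_rpow_const hq₀).continuousOn isClosed_Ici
        (ae_of_all _ fun ω => abs_nonneg (f ω)) hf.abs h_int
  have h_dom : Integrable (fun ω => 2 ^ (q - 1) * (|f ω| ^ q + |∫ ω', f ω' ∂μ| ^ q)) μ :=
    (h_int.add (integrable_const _)).const_mul _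
  have h_center : Integrable (fun ω => |f ω - ∫ ω', f ω' ∂μ| ^ q) μ := by
    refine h_dom.mono' ((Real.continuous_rpow_const hq₀).comp_aestronglyMeasurable
      (hf.sub (integrable_const _)).abs.1) (ae_of_all _ fun ω => ?_)
    rw [Real.norm_of_nonneg (by positivity)]
    exact abs_sub_rpow_le hq _ _
  refine ⟨h_center, (integral_mono h_center h_dom fun ω => abs_sub_rpow_le hq _ _).trans ?_⟩
  rw [integral_const_mul, integral_add h_int (integrable_const _), integral_const,
    probReal_univ, one_smul]
  calc (2 : ℝ) ^ (q - 1) * ((∫ ω, |f ω| ^ q ∂μ) + |∫ ω, f ω ∂μ| ^ q)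
      ≤ 2 ^ (q - 1) * (2 * ∫ ω, |f ω| ^ q ∂μ) := by gcongr; linarith
    _ = 2 ^ q * ∫ ω, |f ω| ^ q ∂μ := by
        rw [Real.rpow_sub_one two_ne_zero]; ring

variable [Fintype ι] {x : ι → Ω → ℝ}

theorem integral_abs_sum_mul_sub_integral_le_of_moment (h_ind : iIndepFun x μ)
    (hx : ∀ s, AEStronglyMeasurable (x s) μ) (hν : 0 ≤ ν)
    (h_int : ∀ s, Integrable (fun ω => |x s ω| ^ (2 + ν)) μ)
    (hC : ∀ s, ∫ ω, |x s ω| ^ (2 + ν) ∂μ ≤ C) (c : ι → ℝ) :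
    ∫ ω, |∑ s, c s * (x s ω - ∫ ω', x s ω' ∂μ)| ∂μ ≤ √((1 + C) * ∑ s, c s ^ 2) := by
  refine (integral_abs_sum_mul_sub_integral_le_sqrt (fun s t => h_ind.indepFun)
    (fun s => memLp_two_of_integrable_abs_rpow (hx s) hν (h_int s)) c).trans ?_
  rw [mul_comm, Finset.sum_mul]
  gcongr with s
  exact (variance_le_expectation_sq (hx s)).trans
    (integral_sq_le_of_integral_abs_rpow_le (hx s) hν (h_int s) (hC s))

theorem integral_abs_quadratic_sub_variance_le_of_moment [LinearOrder ι] (h_ind : iIndepFun x μ)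
    (hx : ∀ s, AEStronglyMeasurable (x s) μ) (hν : 0 ≤ ν) (hC₀ : 0 ≤ C)
    (h_int : ∀ s, Integrable (fun ω => |x s ω| ^ (2 + ν)) μ)
    (hC : ∀ s, ∫ ω, |x s ω| ^ (2 + ν) ∂μ ≤ C) {R : ℝ} (hR : 0 < R) (M : ι → ι → ℝ) :
    ∫ ω, |∑ s, ∑ t, M s t * ((x s ω - ∫ ω', x s ω' ∂μ) * (x t ω - ∫ ω', x t ω' ∂μ)) -
        ∑ s, M s s * Var[x s; μ]| ∂μ ≤
      (2 * (1 + C) + R ^ 2) * √(∑ s, ∑ t, M s t ^ 2) +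
        2 * (2 ^ (2 + ν) * C / R ^ ν * ∑ s, |M s s|) := by
  have h_mem : ∀ s, MemLp (x s) 2 μ := fun s =>
    memLp_two_of_integrable_abs_rpow (hx s) hν (h_int s)
  have h_mem' : ∀ s, MemLp (fun ω => x s ω - ∫ ω', x s ω' ∂μ) 2 μ := fun s =>
    (h_mem s).sub (memLp_const _)
  have h_center := fun s => integral_abs_sub_integral_rpow_le (by linarith : 1 ≤ 2 + ν)
    ((h_mem s).integrable one_le_two) (h_int s)
  simp_rw [fun s => variance_eq_integral (hx s).aemeasurable]
  refine integral_abs_quadratic_sub_diag_le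
    (h_ind.comp (fun s y => y - ∫ ω, x s ω ∂μ) fun s => measurable_id.sub_const _)
    h_mem' (fun s => ?_) (by linarith) (fun s => ?_) (sq_nonneg R) (fun s => ?_) M
  · simp [integral_sub ((h_mem s).integrable one_le_two) (integrable_const _)]
  · exact (variance_eq_integral (hx s).aemeasurable).ge.trans <|
      (variance_le_expectation_sq (hx s)).trans
        (integral_sq_le_of_integral_abs_rpow_le (hx s) hν (h_int s) (hC s))
  · refine (integral_mono ((h_mem' s).integrable_sq.sub (integrable_const _)).pos_part
      ((h_center s).1.div_const _) fun ω => max_sq_sub_sq_zero_le hR hν _).trans ?_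
    rw [integral_div]
    gcongr
    exact (h_center s).2.trans (by gcongr; exact hC s)

end Moments

section ConditionalLaw

variable {ι : Type*}

theorem iIndepFun_eval_of_Iic_rat [Finite ι] {κ : Measure (ι → ℝ)} [IsFiniteMeasure κ]
    (h : ∀ (T : Finset ι) (q : ι → ℚ), κ.real (⋂ s ∈ T, (· s) ⁻¹' Set.Iic (q s : ℝ)) =
      ∏ s ∈ T, κ.real ((· s) ⁻¹' Set.Iic (q s : ℝ))) :
    iIndepFun (fun s (x : ι → ℝ) => x s) κ := by
  rw [iIndepFun_iff_iIndep]
  refine iIndepSets.iIndep (fun s => (measurable_pi_apply s).comap_le)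
    (fun s => {t | ∃ u ∈ (⋃ a : ℚ, {Set.Iic (a : ℝ)}), (fun x : ι → ℝ => x s) ⁻¹' u = t})
    (fun s => Real.isPiSystem_Iic_rat.comap _) (fun s => ?_) ?_
  · conv_lhs => rw [BorelSpace.measurable_eq (α := ℝ), Real.borel_eq_generateFrom_Iic_rat]
    rw [MeasurableSpace.comap_generateFrom]
    rfl
  · rw [iIndepSets_iff]
    intro T f hf
    have h_rat : ∀ s, ∃ a : ℚ, s ∈ T → f s = (fun x : ι → ℝ => x s) ⁻¹' Set.Iic (a : ℝ) := by
      intro s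
      by_cases hs : s ∈ T
      · obtain ⟨u, hu, hus⟩ := hf s hs
        obtain ⟨a, rfl⟩ := Set.mem_iUnion.1 hu
        exact ⟨a, fun _ => hus.symm⟩
      · exact ⟨0, fun h => absurd h hs⟩
    choose q hq using h_rat
    rw [Set.iInter₂_congr hq, Finset.prod_congr rfl fun s hs => by rw [hq s hs],
      ← ENNReal.toReal_eq_toReal_iff' (measure_ne_top _ _)
        (ENNReal.prod_ne_top fun s _ => measure_ne_top _ _), ENNReal.toReal_prod]
    exact h T q

variable {Ω β : Type*} [mΩ : MeasurableSpace Ω] [mβ : MeasurableSpace β] {P : Measure Ω}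
  [IsProbabilityMeasure P] {G : Ω → β} {X : ι → Ω → ℝ}

theorem ae_real_condDistrib_biInter_eq_prod [Finite ι] (hG : Measurable G)
    (hX : ∀ s, Measurable (X s)) (h_ind : CondIndepGiven (mβ.comap G) P X) (T : Finset ι)
    {A : ι → Set ℝ} (hA : ∀ s, MeasurableSet (A s)) :
    ∀ᵐ ω ∂P, (condDistrib (fun ω s => X s ω) G P (G ω)).real (⋂ s ∈ T, (· s) ⁻¹' A s) =
      ∏ s ∈ T, (condDistrib (fun ω s => X s ω) G P (G ω)).real ((· s) ⁻¹' A s) := by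
  have hX' : Measurable fun ω s => X s ω := measurable_pi_lambda _ hX
  have hA' : ∀ s, MeasurableSet ((fun x : ι → ℝ => x s) ⁻¹' A s) := fun s =>
    measurable_pi_apply s (hA s)
  have h_each : ∀ᵐ ω ∂P, ∀ s, (condDistrib (fun ω s => X s ω) G P (G ω)).real ((· s) ⁻¹' A s) =
      (P⟦X s ⁻¹' A s | mβ.comap G⟧) ω :=
    ae_all_iff.2 fun s => condDistrib_ae_eq_condExp hG hX' (hA' s)
  have h_inter := condDistrib_ae_eq_condExp (μ := P) hG hX'
    (T.measurableSet_biInter fun s _ => hA' s)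
  simp only [Set.preimage_iInter, ← Set.preimage_comp] at h_inter
  filter_upwards [h_inter, h_each, h_ind T A fun s _ => hA s] with ω h_inter h_each h_prod
  rw [h_inter, Finset.prod_congr rfl fun s _ => h_each s, ← Finset.prod_apply]
  exact h_prod

theorem ae_iIndepFun_condDistrib [Finite ι] (hG : Measurable G) (hX : ∀ s, Measurable (X s))
    (h_ind : CondIndepGiven (mβ.comap G) P X) :
    ∀ᵐ ω ∂P, iIndepFun (fun s (x : ι → ℝ) => x s) (condDistrib (fun ω s => X s ω) G P (G ω)) := by
  have h_all := ae_all_iff.2 fun T : Finset ι => ae_all_iff.2 fun q : ι → ℚ =>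
    ae_real_condDistrib_biInter_eq_prod hG hX h_ind T fun s => measurableSet_Iic (a := (q s : ℝ))
  filter_upwards [h_all] with ω hω using iIndepFun_eval_of_Iic_rat hω

theorem ae_integral_condDistrib_le_of_condMeanLE {E : Type*} [MeasurableSpace E]
    [StandardBorelSpace E] [Nonempty E] {V : Ω → E} (hG : Measurable G) (hV : Measurable V)
    {f : E → ℝ} (hf : StronglyMeasurable f) {C : ℝ}
    (hC : CondMeanLE (mβ.comap G) P (fun ω => f (V ω)) C) :
    ∀ᵐ ω ∂P, Integrable f (condDistrib V G P (G ω)) ∧ ∫ x, f x ∂condDistrib V G P (G ω) ≤ C := by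
  have h_int : Integrable (fun y : β × E => f y.2) (P.map fun ω => (G ω, V ω)) :=
    (integrable_map_measure (hf.comp_measurable measurable_snd).aestronglyMeasurable
      (hG.prodMk hV).aemeasurable).2 hC.1
  filter_upwards [h_int.condDistrib_ae hG.aemeasurable hV.aemeasurable,
    condExp_ae_eq_integral_condDistrib hG hV.aemeasurable hf hC.1, hC.2] with ω h_int h_eq h_le
  exact ⟨h_int, h_eq ▸ h_le⟩

theorem condExp_ae_eq_integral_eval_condDistrib [Countable ι] (hG : Measurable G)
    (hX : ∀ s, Measurable (X s)) {s : ι} (hs : Integrable (X s) P) :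
    P[X s | mβ.comap G] =ᵐ[P] fun ω => ∫ x, x s ∂condDistrib (fun ω s => X s ω) G P (G ω) :=
  condExp_ae_eq_integral_condDistrib hG (measurable_pi_lambda _ hX).aemeasurable
    (measurable_pi_apply s).stronglyMeasurable hs

theorem measurable_sub_integral_eval_condDistrib [Countable ι] (s : ι) :
    Measurable fun y : β × (ι → ℝ) =>
      y.2 s - ∫ x, x s ∂condDistrib (fun ω s => X s ω) G P y.1 :=
  ((measurable_pi_apply s).comp measurable_snd).sub <|
    (StronglyMeasurable.integral_kernel (κ := condDistrib (fun ω s => X s ω) G P)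
      (f := fun x : ι → ℝ => x s) (measurable_pi_apply s).stronglyMeasurable).measurable.comp
      measurable_fst

theorem condVar_ae_eq_variance_condDistrib [Countable ι] (hG : Measurable G)
    (hX : ∀ s, Measurable (X s)) {s : ι} (hs : MemLp (X s) 2 P) :
    Var[X s; P | mβ.comap G] =ᵐ[P]
      fun ω => Var[(· s); condDistrib (fun ω s => X s ω) G P (G ω)] := by
  have h_mean := condExp_ae_eq_integral_eval_condDistrib hG hX (hs.integrable one_le_two)
  have h_center : (fun ω => (X s ω - (P[X s | mβ.comap G]) ω) ^ 2) =ᵐ[P] fun ω =>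
      (X s ω - ∫ x, x s ∂condDistrib (fun ω s => X s ω) G P (G ω)) ^ 2 := by
    filter_upwards [h_mean] with ω h using by rw [h]
  refine (condExp_congr_ae h_center).trans <| (condExp_prod_ae_eq_integral_condDistrib
    (f := fun y : β × (ι → ℝ) => (y.2 s - ∫ x, x s ∂condDistrib (fun ω s => X s ω) G P y.1) ^ 2) hG
    (measurable_pi_lambda _ hX).aemeasurable
    ((measurable_sub_integral_eval_condDistrib s).pow_const 2).stronglyMeasurable
    ((hs.sub (hs.condExp one_le_two)).integrable_sq.congr h_center)).trans <|
    ae_of_all _ fun ω => (variance_eq_integral (measurable_pi_apply s).aemeasurable).symm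

theorem measurable_variance_eval_condDistrib [Countable ι] (s : ι) :
    Measurable fun g : β => Var[(· s); condDistrib (fun ω s => X s ω) G P g] := by
  simp_rw [fun g => variance_eq_integral (X := (· s)) (μ := condDistrib (fun ω s => X s ω) G P g)
    (measurable_pi_apply s).aemeasurable]
  exact (StronglyMeasurable.integral_kernel_prod_right' (κ := condDistrib (fun ω s => X s ω) G P)
    ((measurable_sub_integral_eval_condDistrib s).pow_const 2).stronglyMeasurable).measurable

theorem measurable_centered_variance_eval_condDistrib [Countable ι] :
    Measurable fun y : β × (ι → ℝ) => (y.1,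
      fun s => y.2 s - ∫ x, x s ∂condDistrib (fun ω s => X s ω) G P y.1,
      fun s => Var[(· s); condDistrib (fun ω s => X s ω) G P y.1]) :=
  measurable_fst.prodMk <| (measurable_pi_lambda _ measurable_sub_integral_eval_condDistrib).prodMk
    (measurable_pi_lambda _ fun s => (measurable_variance_eval_condDistrib s).comp measurable_fst)

theorem measurable_abs_sum_mul_eval [Fintype ι] {c : ι → β → ℝ} (hc : ∀ s, Measurable (c s)) :
    Measurable fun y : β × (ι → ℝ) × (ι → ℝ) => |∑ s, c s y.1 * y.2.1 s| :=
  (Finset.measurable_fun_sum _ fun s _ => ((hc s).comp measurable_fst).mul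
    ((measurable_pi_apply s).comp (measurable_fst.comp measurable_snd))).abs

theorem measurable_abs_quadratic_sub_diag_eval [Fintype ι] {M : ι → ι → β → ℝ}
    (hM : ∀ s t, Measurable (M s t)) :
    Measurable fun y : β × (ι → ℝ) × (ι → ℝ) =>
      |∑ s, ∑ t, M s t y.1 * (y.2.1 s * y.2.1 t) - ∑ s, M s s y.1 * y.2.2 s| := by
  have h_coord : ∀ s, Measurable fun y : β × (ι → ℝ) × (ι → ℝ) => y.2.1 s := fun s =>
    (measurable_pi_apply s).comp (measurable_fst.comp measurable_snd)
  exact (Measurable.sub (Finset.measurable_fun_sum _ fun s _ => Finset.measurable_fun_sum _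
    fun t _ => ((hM s t).comp measurable_fst).mul ((h_coord s).mul (h_coord t)))
    (Finset.measurable_fun_sum _ fun s _ => ((hM s s).comp measurable_fst).mul
      ((measurable_pi_apply s).comp (measurable_snd.comp measurable_snd)))).abs

theorem condExp_comap_le_of_forall_iIndepFun_law [Finite ι] {ν C : ℝ} (hG : Measurable G)
    (hX : ∀ s, Measurable (X s)) (h_ind : CondIndepGiven (mβ.comap G) P X) (hν : 0 ≤ ν)
    (hC : ∀ s, CondMeanLE (mβ.comap G) P (fun ω => |X s ω| ^ (2 + ν)) C)
    {Φ : β × (ι → ℝ) × (ι → ℝ) → ℝ} (hΦ : Measurable Φ) {b : β → ℝ}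
    (h_int : Integrable (fun ω => Φ (G ω, fun s => X s ω - (P[X s | mβ.comap G]) ω,
      fun s => (Var[X s; P | mβ.comap G]) ω)) P)
    (h_le : ∀ (g : β) (μ : Measure (ι → ℝ)) [IsProbabilityMeasure μ],
      iIndepFun (fun s (x : ι → ℝ) => x s) μ → (∀ s, Integrable (fun x => |x s| ^ (2 + ν)) μ) →
      (∀ s, ∫ x, |x s| ^ (2 + ν) ∂μ ≤ C) →
      ∫ x, Φ (g, fun s => x s - ∫ x, x s ∂μ, fun s => Var[(· s); μ]) ∂μ ≤ b g) :
    P[fun ω => Φ (G ω, fun s => X s ω - (P[X s | mβ.comap G]) ω,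
      fun s => (Var[X s; P | mβ.comap G]) ω) | mβ.comap G] ≤ᵐ[P] fun ω => b (G ω) := by
  have h_mem := fun s => memLp_two_of_integrable_abs_rpow (hX s).aestronglyMeasurable hν (hC s).1
  have h_mean := ae_all_iff.2 fun s => condExp_ae_eq_integral_eval_condDistrib hG hX
    ((h_mem s).integrable one_le_two)
  have h_var := ae_all_iff.2 fun s => condVar_ae_eq_variance_condDistrib hG hX (h_mem s)
  have h_eq : (fun ω => Φ (G ω, fun s => X s ω - (P[X s | mβ.comap G]) ω,
      fun s => (Var[X s; P | mβ.comap G]) ω)) =ᵐ[P] fun ω => Φ (G ω,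
      fun s => X s ω - ∫ x, x s ∂condDistrib (fun ω s => X s ω) G P (G ω),
      fun s => Var[(· s); condDistrib (fun ω s => X s ω) G P (G ω)]) := by
    filter_upwards [h_mean, h_var] with ω h_mean h_var
    simp only [h_mean, h_var]
  let center : β × (ι → ℝ) → β × (ι → ℝ) × (ι → ℝ) := fun y => (y.1,
    fun s => y.2 s - ∫ x, x s ∂condDistrib (fun ω s => X s ω) G P y.1,
    fun s => Var[(· s); condDistrib (fun ω s => X s ω) G P y.1])
  have h_center : Measurable center := measurable_centered_variance_eval_condDistrib
  have h_condExp := condExp_prod_ae_eq_integral_condDistrib (f := Φ ∘ center) hG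
    (measurable_pi_lambda _ hX).aemeasurable (hΦ.comp h_center).stronglyMeasurable
    (h_int.congr h_eq)
  filter_upwards [(condExp_congr_ae h_eq).trans h_condExp, ae_iIndepFun_condDistrib hG hX h_ind,
    ae_all_iff.2 fun s => ae_integral_condDistrib_le_of_condMeanLE hG (measurable_pi_lambda _ hX)
      (f := fun x => |x s| ^ (2 + ν))
      ((measurable_pi_apply s).abs.pow_const _).stronglyMeasurable (hC s)] with ω h h_ind hC
  exact h.trans_le (h_le _ _ h_ind (fun s => (hC s).1) fun s => (hC s).2)

end ConditionalLaw

section ConditionalForms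

variable {Ω ι : Type*} [Fintype ι] {m : MeasurableSpace Ω} [mΩ : MeasurableSpace Ω]
  {P : Measure Ω} [IsProbabilityMeasure P] {X : ι → Ω → ℝ} {ν C : ℝ}

theorem condExp_abs_sum_mul_sub_condExp_le (hm : m ≤ mΩ) (hX : ∀ s, Measurable (X s))
    (h_ind : CondIndepGiven m P X) (hν : 0 ≤ ν)
    (hC : ∀ s, CondMeanLE m P (fun ω => |X s ω| ^ (2 + ν)) C)
    {c : ι → Ω → ℝ} (hc : ∀ s, Measurable[m] (c s))
    (h_int : Integrable (fun ω => ∑ s, c s ω * (X s ω - (P[X s | m]) ω)) P) :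
    P[fun ω => |∑ s, c s ω * (X s ω - (P[X s | m]) ω)| | m] ≤ᵐ[P]
      fun ω => √((1 + C) * ∑ s, c s ω ^ 2) := by
  have h := @condExp_comap_le_of_forall_iIndepFun_law ι Ω Ω mΩ m P _ id X _ ν C
    (measurable_id'' hm) hX
  simp only [MeasurableSpace.comap_id, id_eq] at h
  refine h h_ind hν hC (Φ := fun y => |∑ s, c s y.1 * y.2.1 s|)
    (b := fun ω => √((1 + C) * ∑ s, c s ω ^ 2)) (@measurable_abs_sum_mul_eval ι Ω m _ c hc)
    h_int.abs fun ω μ _ h_ind h_int hC => ?_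
  exact integral_abs_sum_mul_sub_integral_le_of_moment h_ind
    (fun s => (measurable_pi_apply s).aestronglyMeasurable) hν h_int hC fun s => c s ω

theorem condExp_abs_quadratic_sub_condVar_le [LinearOrder ι] (hm : m ≤ mΩ)
    (hX : ∀ s, Measurable (X s)) (h_ind : CondIndepGiven m P X) (hν : 0 ≤ ν)
    (hC₀ : 0 ≤ C) (hC : ∀ s, CondMeanLE m P (fun ω => |X s ω| ^ (2 + ν)) C)
    {M : ι → ι → Ω → ℝ} (hM : ∀ s t, Measurable[m] (M s t))
    (h_int : Integrable (fun ω => ∑ s, ∑ t, M s t ω *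
      ((X s ω - (P[X s | m]) ω) * (X t ω - (P[X t | m]) ω)) -
      ∑ s, M s s ω * (Var[X s; P | m]) ω) P) {R : ℝ} (hR : 0 < R) :
    P[fun ω => |∑ s, ∑ t, M s t ω *
        ((X s ω - (P[X s | m]) ω) * (X t ω - (P[X t | m]) ω)) -
        ∑ s, M s s ω * (Var[X s; P | m]) ω| | m] ≤ᵐ[P]
      fun ω => (2 * (1 + C) + R ^ 2) * √(∑ s, ∑ t, M s t ω ^ 2) +
        2 * (2 ^ (2 + ν) * C / R ^ ν * ∑ s, |M s s ω|) := by
  have h := @condExp_comap_le_of_forall_iIndepFun_law ι Ω Ω mΩ m P _ id X _ ν C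
    (measurable_id'' hm) hX
  simp only [MeasurableSpace.comap_id, id_eq] at h
  refine h h_ind hν hC (Φ := fun y => |∑ s, ∑ t, M s t y.1 * (y.2.1 s * y.2.1 t) -
    ∑ s, M s s y.1 * y.2.2 s|) (b := fun ω => (2 * (1 + C) + R ^ 2) *
      √(∑ s, ∑ t, M s t ω ^ 2) + 2 * (2 ^ (2 + ν) * C / R ^ ν * ∑ s, |M s s ω|))
      (@measurable_abs_quadratic_sub_diag_eval ι Ω m _ M hM) h_int.abs
      fun ω μ _ h_ind h_int hC => ?_
  exact integral_abs_quadratic_sub_variance_le_of_moment h_ind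
    (fun s => (measurable_pi_apply s).aestronglyMeasurable) hν hC₀ h_int hC hR fun s t => M s t ω

end ConditionalForms

section Shares

theorem sq_sum_mul_le_sum_mul_sq {J : Type*} [Fintype J] {w : J → ℝ} (hw : ∀ s, 0 ≤ w s)
    (hw_sum : ∑ s, w s ≤ 1) (x : J → ℝ) : (∑ s, w s * x s) ^ 2 ≤ ∑ s, w s * x s ^ 2 := by
  have h_nonneg : ∀ s, 0 ≤ w s * x s ^ 2 := fun s => mul_nonneg (hw s) (sq_nonneg _)
  calc (∑ s, w s * x s) ^ 2 ≤ (∑ s, w s) * ∑ s, w s * x s ^ 2 :=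
        Finset.sum_sq_le_sum_mul_sum_of_sq_le_mul _ (fun s _ => hw s) (fun s _ => h_nonneg s)
          fun s _ => by rw [mul_pow, sq (w s), mul_assoc]
    _ ≤ ∑ s, w s * x s ^ 2 :=
        mul_le_of_le_one_left (Finset.sum_nonneg fun s _ => h_nonneg s) hw_sum

theorem le_one_of_sum_le_one {J : Type*} [Fintype J] {w : J → ℝ} (hw : ∀ s, 0 ≤ w s)
    (hw_sum : ∑ s, w s ≤ 1) (s : J) : w s ≤ 1 :=
  (Finset.single_le_sum (fun s _ => hw s) (Finset.mem_univ s)).trans hw_sum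

theorem abs_sum_mul_mul_le {I J : Type*} [Fintype I] {w b : I → J → ℝ} {K : ℝ}
    (hw : ∀ i s, 0 ≤ w i s) (hb : ∀ i s, |b i s| ≤ K) (s t : J) :
    |∑ i, w i s * w i t * b i t| ≤ K * ∑ i, w i s * w i t := by
  rw [Finset.mul_sum]
  refine (Finset.abs_sum_le_sum_abs _ _).trans (Finset.sum_le_sum fun i _ => ?_)
  rw [abs_mul, abs_of_nonneg (mul_nonneg (hw i s) (hw i t)), mul_comm]
  exact mul_le_mul_of_nonneg_right (hb i t) (mul_nonneg (hw i s) (hw i t))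

variable {I J : Type*} [Fintype I] [Fintype J] {w : I → J → ℝ} {m K : ℝ}

theorem sum_sq_sum_mul_le (hw : ∀ i s, 0 ≤ w i s) (hw_sum : ∀ i, ∑ s, w i s ≤ 1)
    (hm : ∀ s, ∑ i, w i s ≤ m) (hm₀ : 0 ≤ m) (g : I → ℝ) :
    ∑ s, (∑ i, w i s * g i) ^ 2 ≤ m * ∑ i, g i ^ 2 := by
  have h_nonneg : ∀ i s, 0 ≤ w i s * g i ^ 2 := fun i s => mul_nonneg (hw i s) (sq_nonneg _)
  calc ∑ s, (∑ i, w i s * g i) ^ 2 ≤ ∑ s, (∑ i, w i s) * ∑ i, w i s * g i ^ 2 := by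
        gcongr with s
        exact Finset.sum_sq_le_sum_mul_sum_of_sq_le_mul _ (fun i _ => hw i s)
          (fun i _ => h_nonneg i s) fun i _ => by rw [mul_pow, sq (w i s), mul_assoc]
    _ ≤ ∑ s, m * ∑ i, w i s * g i ^ 2 := by
        gcongr with s
        · exact Finset.sum_nonneg fun i _ => h_nonneg i s
        · exact hm s
    _ = m * ∑ i, (∑ s, w i s) * g i ^ 2 := by
        rw [← Finset.mul_sum, Finset.sum_comm]
        simp only [Finset.sum_mul]
    _ ≤ m * ∑ i, g i ^ 2 := by
        gcongr with i
        exact mul_le_of_le_one_left (sq_nonneg _) (hw_sum i)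

theorem sum_sum_sq_sum_mul_mul_le {b : I → J → ℝ} (hw : ∀ i s, 0 ≤ w i s)
    (hw_sum : ∀ i, ∑ s, w i s ≤ 1) (hm : ∀ s, ∑ i, w i s ≤ m) (hm₀ : 0 ≤ m)
    (hb : ∀ i s, |b i s| ≤ K) :
    ∑ s, ∑ t, (∑ i, w i s * w i t * b i t) ^ 2 ≤ K ^ 2 * (m * Fintype.card I) := by
  have h_nonneg : ∀ s t, 0 ≤ ∑ i, w i s * w i t := fun s t =>
    Finset.sum_nonneg fun i _ => mul_nonneg (hw i s) (hw i t)
  have h_le : ∀ s t, ∑ i, w i s * w i t ≤ m := fun s t =>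
    (Finset.sum_le_sum fun i _ => mul_le_of_le_one_right (hw i s)
      (le_one_of_sum_le_one (hw i) (hw_sum i) t)).trans (hm s)
  calc ∑ s, ∑ t, (∑ i, w i s * w i t * b i t) ^ 2
      ≤ ∑ s, ∑ t, K ^ 2 * (m * ∑ i, w i s * w i t) := by
        gcongr with s _ t
        rw [← sq_abs]
        refine (pow_le_pow_left₀ (abs_nonneg _) (abs_sum_mul_mul_le hw hb s t) 2).trans ?_
        rw [mul_pow, sq (∑ i, w i s * w i t)]
        gcongr
        · exact h_nonneg s t
        · exact h_le s t
    _ = K ^ 2 * (m * ∑ i, (∑ s, w i s) * ∑ t, w i t) := by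
        simp only [← Finset.mul_sum, Finset.sum_comm (s := Finset.univ (α := J))
          (t := Finset.univ (α := I)), Finset.sum_mul_sum]
    _ ≤ K ^ 2 * (m * ∑ _i : I, 1) := by
        gcongr with i
        exact mul_le_one₀ (hw_sum i) (Finset.sum_nonneg fun s _ => hw i s) (hw_sum i)
    _ = K ^ 2 * (m * Fintype.card I) := by simp

theorem sum_abs_sum_mul_mul_self_le {b : I → J → ℝ} (hw : ∀ i s, 0 ≤ w i s)
    (hw_sum : ∀ i, ∑ s, w i s ≤ 1) (hb : ∀ i s, |b i s| ≤ K) (hK : 0 ≤ K) :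
    ∑ s, |∑ i, w i s * w i s * b i s| ≤ K * Fintype.card I := by
  calc ∑ s, |∑ i, w i s * w i s * b i s| ≤ ∑ s, K * ∑ i, w i s :=
        Finset.sum_le_sum fun s _ => (abs_sum_mul_mul_le hw hb s s).trans <| by
          gcongr with i
          exact mul_le_of_le_one_right (hw i s) (le_one_of_sum_le_one (hw i) (hw_sum i) s)
    _ = K * ∑ i, ∑ s, w i s := by rw [← Finset.mul_sum, Finset.sum_comm]
    _ ≤ K * ∑ _i : I, 1 := by gcongr with i; exact hw_sum i
    _ = K * Fintype.card I := by simp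

end Shares

section ConditionalMoments

variable {Ω : Type*} {m : MeasurableSpace Ω} [mΩ : MeasurableSpace Ω] {P : Measure Ω}
  [IsProbabilityMeasure P]

theorem CondMeanLE.integral_le {f : Ω → ℝ} {C : ℝ} (hm : m ≤ mΩ) (hf : CondMeanLE m P f C) :
    ∫ ω, f ω ∂P ≤ C := by
  rw [← integral_condExp hm]
  simpa using integral_mono_ae integrable_condExp (integrable_const C) hf.2

theorem CondMeanLE.sq_of_abs_rpow {f : Ω → ℝ} {C ν : ℝ} (hm : m ≤ mΩ)
    (hf_meas : AEStronglyMeasurable f P) (hν : 0 ≤ ν)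
    (hf : CondMeanLE m P (fun ω => |f ω| ^ (2 + ν)) C) :
    CondMeanLE m P (fun ω => f ω ^ 2) (1 + C) := by
  have h_int := (memLp_two_of_integrable_abs_rpow hf_meas hν hf.1).integrable_sq
  refine ⟨h_int, ?_⟩
  filter_upwards [hf.2, condExp_mono (m := m) h_int ((integrable_const 1).add hf.1)
    (ae_of_all _ fun ω => sq_le_one_add_abs_rpow hν (f ω)),
    condExp_add (integrable_const (1 : ℝ)) hf.1 m] with ω hC h_mono h_add
  refine h_mono.trans (h_add.trans_le ?_)
  rw [Pi.add_apply, condExp_const hm]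
  gcongr

theorem CondMeanLE.sq_condExp {f : Ω → ℝ} {C : ℝ} (hm : m ≤ mΩ) (hf : MemLp f 2 P)
    (hC : CondMeanLE m P (fun ω => f ω ^ 2) C) :
    CondMeanLE m P (fun ω => (P[f | m]) ω ^ 2) C := by
  have h_int : Integrable ((P[f | m]) ^ 2) P := (hf.condExp one_le_two).integrable_sq
  refine ⟨h_int, ?_⟩
  change ∀ᵐ ω ∂P, (P[(P[f | m]) ^ 2 | m]) ω ≤ C
  rw [condExp_of_stronglyMeasurable hm (stronglyMeasurable_condExp.pow 2) h_int]
  filter_upwards [even_two.convexOn_pow.map_condExp_le_univ hm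
    (continuous_pow 2).lowerSemicontinuous (hf.integrable one_le_two) hC.1, hC.2]
    with ω h_jensen h_le using h_jensen.trans h_le

variable {J : Type*} [Fintype J] {w x b : J → Ω → ℝ} {C K : ℝ}

theorem integral_sum_mul_le_of_condMeanLE (hm : m ≤ mΩ) (hw_meas : ∀ s, Measurable[m] (w s))
    (hw : ∀ᵐ ω ∂P, (∀ s, 0 ≤ w s ω) ∧ ∑ s, w s ω ≤ 1)
    (hx : ∀ s, CondMeanLE m P (x s) C) :
    Integrable (fun ω => ∑ s, w s ω * x s ω) P ∧ ∫ ω, ∑ s, w s ω * x s ω ∂P ≤ |C| := by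
  have hw_le : ∀ s, ∀ᵐ ω ∂P, ‖w s ω‖ ≤ 1 := fun s => by
    filter_upwards [hw] with ω hω
    rw [Real.norm_eq_abs, abs_of_nonneg (hω.1 s)]
    exact le_one_of_sum_le_one hω.1 hω.2 s
  have h_int : ∀ s, Integrable (fun ω => w s ω * x s ω) P := fun s =>
    (hx s).1.bdd_mul ((hw_meas s).mono hm le_rfl).aestronglyMeasurable (hw_le s)
  have h_int_sum := integrable_finsetSum Finset.univ fun s _ => h_int s
  refine ⟨h_int_sum, ?_⟩
  have h_condExp : ∀ᵐ ω ∂P, (P[fun ω => ∑ s, w s ω * x s ω | m]) ω ≤ |C| := by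
    filter_upwards [condExp_finsetSum (fun s (_ : s ∈ Finset.univ) => h_int s) m,
      ae_all_iff.2 fun s => condExp_stronglyMeasurable_mul_of_bound hm
        (hw_meas s).stronglyMeasurable (hx s).1 1 (hw_le s), ae_all_iff.2 fun s => (hx s).2, hw]
      with ω h_sum h_mul h_le hω
    simp only [Finset.sum_fn] at h_sum
    calc (P[fun ω => ∑ s, w s ω * x s ω | m]) ω = ∑ s, (P[fun ω => w s ω * x s ω | m]) ω := h_sum
      _ = ∑ s, w s ω * (P[x s | m]) ω := Finset.sum_congr rfl fun s _ => h_mul s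
      _ ≤ ∑ s, w s ω * |C| := by
          gcongr with s
          · exact hω.1 s
          · exact (h_le s).trans (le_abs_self C)
      _ ≤ |C| := by
          rw [← Finset.sum_mul]
          exact mul_le_of_le_one_left (abs_nonneg C) hω.2
  rw [← integral_condExp hm]
  simpa using integral_mono_ae integrable_condExp (integrable_const |C|) h_condExp

theorem memLp_two_sum_mul_mul_of_condMeanLE (hm : m ≤ mΩ) (hw_meas : ∀ s, Measurable[m] (w s))
    (hw : ∀ᵐ ω ∂P, (∀ s, 0 ≤ w s ω) ∧ ∑ s, w s ω ≤ 1) (hx : ∀ s, AEStronglyMeasurable (x s) P)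
    (hC : ∀ s, CondMeanLE m P (fun ω => x s ω ^ 2) C) (hb : ∀ s, AEStronglyMeasurable (b s) P)
    (hK : ∀ᵐ ω ∂P, ∀ s, |b s ω| ≤ K) :
    MemLp (fun ω => ∑ s, w s ω * x s ω * b s ω) 2 P ∧
      ∫ ω, (∑ s, w s ω * x s ω * b s ω) ^ 2 ∂P ≤ K ^ 2 * |C| := by
  have h_bound := integral_sum_mul_le_of_condMeanLE hm hw_meas hw hC
  have h_sq_le : ∀ᵐ ω ∂P, (∑ s, w s ω * x s ω * b s ω) ^ 2 ≤
      K ^ 2 * ∑ s, w s ω * x s ω ^ 2 := by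
    filter_upwards [hw, hK] with ω hω hK
    simp only [mul_assoc]
    refine (sq_sum_mul_le_sum_mul_sq hω.1 hω.2 _).trans ?_
    rw [Finset.mul_sum]
    refine Finset.sum_le_sum fun s _ => ?_
    rw [mul_pow, mul_left_comm (K ^ 2), mul_comm (K ^ 2)]
    refine mul_le_mul_of_nonneg_left (mul_le_mul_of_nonneg_left ?_ (sq_nonneg _)) (hω.1 s)
    exact sq_le_sq' (neg_le_of_abs_le (hK s)) (le_of_abs_le (hK s))
  have h_meas : AEStronglyMeasurable (fun ω => ∑ s, w s ω * x s ω * b s ω) P :=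
    Finset.aestronglyMeasurable_fun_sum _ fun s _ =>
      (((hw_meas s).mono hm le_rfl).aestronglyMeasurable.mul (hx s)).mul (hb s)
  have h_int_sq : Integrable (fun ω => (∑ s, w s ω * x s ω * b s ω) ^ 2) P :=
    (h_bound.1.const_mul (K ^ 2)).mono' (h_meas.pow 2) <| by
      filter_upwards [h_sq_le] with ω h using by rwa [Real.norm_of_nonneg (sq_nonneg _)]
  refine ⟨(memLp_two_iff_integrable_sq h_meas).2 h_int_sq, ?_⟩
  calc ∫ ω, (∑ s, w s ω * x s ω * b s ω) ^ 2 ∂P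
      ≤ ∫ ω, K ^ 2 * ∑ s, w s ω * x s ω ^ 2 ∂P :=
        integral_mono_ae h_int_sq (h_bound.1.const_mul _) h_sq_le
    _ ≤ K ^ 2 * |C| := by
        rw [integral_const_mul]
        exact mul_le_mul_of_nonneg_left h_bound.2 (sq_nonneg K)

end ConditionalMoments

section RegionalArrays

variable {Ω : ℕ → Type*} {N : ℕ → ℕ}

/-- The average over the regions of an array indexed by regions, as an array of random variables. It
is zero in the rows without regions. -/
noncomputable def regionAvg : (∀ S, Fin (N S) → Ω S → ℝ) →ₗ[ℝ] (Σ S, Ω S) → ℝ where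
  toFun g x := (∑ i, g x.1 i x.2) / N x.1
  map_add' f g := by ext x; simp [Finset.sum_add_distrib, add_div]
  map_smul' c g := by ext x; simp [← Finset.mul_sum, mul_div_assoc]

theorem regionAvg_apply (g : ∀ S, Fin (N S) → Ω S → ℝ) (x : Σ S, Ω S) :
    regionAvg g x = (∑ i, g x.1 i x.2) / N x.1 :=
  rfl

theorem sum_div_card_le {n : ℕ} {a : Fin n → ℝ} {C : ℝ} (hC : 0 ≤ C) (ha : ∀ i, a i ≤ C) :
    (∑ i, a i) / n ≤ C :=
  div_le_of_le_mul₀ n.cast_nonneg hC <|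
    (Finset.sum_le_card_nsmul _ _ C fun i _ => ha i).trans_eq (by simp [mul_comm])

variable [∀ S, MeasurableSpace (Ω S)] {P : ∀ S, Measure (Ω S)}

/-- The arrays indexed by regions whose second moments are bounded uniformly over the rows and the
regions. -/
def unifL2 (P : ∀ S, Measure (Ω S)) (N : ℕ → ℕ) : Submodule ℝ (∀ S, Fin (N S) → Ω S → ℝ) where
  carrier := {g | ∃ C, ∀ S i, MemLp (g S i) 2 (P S) ∧ ∫ ω, g S i ω ^ 2 ∂P S ≤ C}
  zero_mem' := ⟨0, fun S i => by simp⟩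
  add_mem' := by
    rintro f g ⟨C, hf⟩ ⟨D, hg⟩
    refine ⟨2 * (C + D), fun S i => ⟨(hf S i).1.add (hg S i).1, ?_⟩⟩
    have hf_sq := (hf S i).1.integrable_sq
    have hg_sq := (hg S i).1.integrable_sq
    calc ∫ ω, (f S i ω + g S i ω) ^ 2 ∂P S ≤ ∫ ω, 2 * (f S i ω ^ 2 + g S i ω ^ 2) ∂P S :=
          integral_mono ((hf S i).1.add (hg S i).1).integrable_sq ((hf_sq.add hg_sq).const_mul 2)
            fun ω => add_sq_le
      _ = 2 * (∫ ω, f S i ω ^ 2 ∂P S + ∫ ω, g S i ω ^ 2 ∂P S) := by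
          rw [integral_const_mul, integral_add hf_sq hg_sq]
      _ ≤ 2 * (C + D) := by gcongr; exacts [(hf S i).2, (hg S i).2]
  smul_mem' := by
    rintro c g ⟨C, hg⟩
    refine ⟨c ^ 2 * C, fun S i => ⟨(hg S i).1.const_mul c, ?_⟩⟩
    simp only [Pi.smul_apply, smul_eq_mul, mul_pow, integral_const_mul]
    exact mul_le_mul_of_nonneg_left (hg S i).2 (sq_nonneg c)

/-- The arrays indexed by regions whose `L²` norms vanish on average over the regions. -/
def IsNegligible (P : ∀ S, Measure (Ω S)) (g : ∀ S, Fin (N S) → Ω S → ℝ) : Prop :=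
  (∀ S i, MemLp (g S i) 2 (P S)) ∧
    Tendsto (fun S => (∑ i, √(∫ ω, g S i ω ^ 2 ∂P S)) / N S) atTop (𝓝 0)

variable {f g : ∀ S, Fin (N S) → Ω S → ℝ}

theorem IsNegligible.of_sum_integral_sq (hg : ∀ S i, MemLp (g S i) 2 (P S))
    (h : Tendsto (fun S => (∑ i, ∫ ω, g S i ω ^ 2 ∂P S) / N S) atTop (𝓝 0)) :
    IsNegligible P g := by
  have h_sqrt := h.sqrt
  rw [Real.sqrt_zero] at h_sqrt
  refine ⟨hg, squeeze_zero (fun S => by positivity) (fun S => Real.le_sqrt_of_sq_le ?_) h_sqrt⟩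
  have h_cauchy := sq_sum_le_card_mul_sum_sq (s := Finset.univ)
    (f := fun i => √(∫ ω, g S i ω ^ 2 ∂P S))
  simp only [Real.sq_sqrt (integral_nonneg fun _ => sq_nonneg _), Finset.card_univ,
    Fintype.card_fin] at h_cauchy
  rcases (N S).eq_zero_or_pos with hN | hN
  · simp [hN]
  · rw [div_pow, div_le_div_iff₀ (by positivity) (by positivity)]
    nlinarith [mul_le_mul_of_nonneg_right h_cauchy (N S).cast_nonneg (α := ℝ)]

theorem integrable_regionAvg_mul (hf : ∀ S i, MemLp (f S i) 2 (P S))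
    (hg : ∀ S i, MemLp (g S i) 2 (P S)) (S : ℕ) :
    Integrable (fun ω => regionAvg (f * g) ⟨S, ω⟩) (P S) := by
  have h : Integrable (fun ω => (∑ i, f S i ω * g S i ω) / N S) (P S) :=
    (integrable_finsetSum _ fun i _ => (hf S i).integrable_mul (hg S i)).div_const _
  simpa only [regionAvg_apply, Pi.mul_apply] using h

theorem integral_abs_regionAvg_mul_le (hf : ∀ S i, MemLp (f S i) 2 (P S))
    (hg : ∀ S i, MemLp (g S i) 2 (P S)) (S : ℕ) :
    ∫ ω, |regionAvg (f * g) ⟨S, ω⟩| ∂P S ≤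
      (∑ i, √(∫ ω, f S i ω ^ 2 ∂P S) * √(∫ ω, g S i ω ^ 2 ∂P S)) / N S := by
  have h_int : ∀ i, Integrable (fun ω => |f S i ω * g S i ω|) (P S) := fun i =>
    ((hf S i).integrable_mul (hg S i)).abs
  calc ∫ ω, |regionAvg (f * g) ⟨S, ω⟩| ∂P S
      ≤ ∫ ω, (∑ i, |f S i ω * g S i ω|) / N S ∂P S := by
        refine integral_mono (integrable_regionAvg_mul hf hg S).abs
          ((integrable_finsetSum _ fun i _ => h_int i).div_const _) fun ω => ?_
        simp only [regionAvg_apply, abs_div, Nat.abs_cast]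
        gcongr
        exact Finset.abs_sum_le_sum_abs _ _
    _ = (∑ i, ∫ ω, |f S i ω * g S i ω| ∂P S) / N S := by
        rw [integral_div, integral_finsetSum _ fun i _ => h_int i]
    _ ≤ (∑ i, √(∫ ω, f S i ω ^ 2 ∂P S) * √(∫ ω, g S i ω ^ 2 ∂P S)) / N S := by
        gcongr with i
        exact integral_abs_mul_le_sqrt_mul_sqrt (hf S i) (hg S i)

theorem bddInProb_regionAvg_mul [∀ S, IsFiniteMeasure (P S)] (hf : f ∈ unifL2 P N)
    (hg : g ∈ unifL2 P N) : BddInProb P (regionAvg (f * g)) := by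
  obtain ⟨C, hf⟩ := hf
  obtain ⟨D, hg⟩ := hg
  have hf_mem := fun S i => (hf S i).1
  have hg_mem := fun S i => (hg S i).1
  refine .of_integral_abs_le (integrable_regionAvg_mul hf_mem hg_mem) fun S =>
    (integral_abs_regionAvg_mul_le hf_mem hg_mem S).trans <|
      sum_div_card_le (by positivity : 0 ≤ √C * √D) fun i => ?_
  gcongr
  exacts [(hf S i).2, (hg S i).2]

theorem tendsto_regionAvg_mul_zero [∀ S, IsProbabilityMeasure (P S)] (hf : f ∈ unifL2 P N)
    (hg : IsNegligible P g) : Tendsto (regionAvg (f * g)) (highProb P) (𝓝 0) := by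
  obtain ⟨C, hf⟩ := hf
  have hf_mem := fun S i => (hf S i).1
  refine tendsto_highProb_zero_of_integral_abs (integrable_regionAvg_mul hf_mem hg.1) <|
    squeeze_zero (fun S => by positivity) (fun S => integral_abs_regionAvg_mul_le hf_mem hg.1 S) ?_
  have h_lim := hg.2.const_mul √C
  rw [mul_zero] at h_lim
  refine squeeze_zero (fun S => by positivity) (fun S => ?_) h_lim
  rw [← mul_div_assoc, Finset.mul_sum]
  gcongr with i
  exact (hf S i).2

end RegionalArrays

theorem mem_unifL2_of_condMeanLE {Ω : ℕ → Type*} {m : ∀ S, MeasurableSpace (Ω S)}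
    [mΩ : ∀ S, MeasurableSpace (Ω S)] {P : ∀ S, Measure (Ω S)} [∀ S, IsProbabilityMeasure (P S)]
    {N : ℕ → ℕ} {g : ∀ S, Fin (N S) → Ω S → ℝ} (hm : ∀ S, m S ≤ mΩ S)
    (hg_meas : ∀ S i, AEStronglyMeasurable (g S i) (P S))
    (hg : ∃ C, ∀ S i, CondMeanLE (m S) (P S) (fun ω => g S i ω ^ 2) C) : g ∈ unifL2 P N :=
  hg.imp fun _ hg => fun S i => ⟨(memLp_two_iff_integrable_sq (hg_meas S i)).2 (hg S i).1,
    (hg S i).integral_le (hm S)⟩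

section Residuals

variable {ι κ : Type*} [Fintype ι] [Fintype κ] [DecidableEq κ]

/-- The residuals of the least squares regression of `v` on the columns of `Z`. Meaningful when
`Zᵀ * Z` is invertible. -/
noncomputable def olsResidual (Z : Matrix ι κ ℝ) (v : ι → ℝ) : ι → ℝ :=
  v - Z *ᵥ ((Zᵀ * Z)⁻¹ *ᵥ (Zᵀ *ᵥ v))

theorem olsResidual_add_mulVec {Z : Matrix ι κ ℝ} (hZ : IsUnit (Zᵀ * Z).det) (v : ι → ℝ)
    (γ : κ → ℝ) : olsResidual Z (v + Z *ᵥ γ) = olsResidual Z v := by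
  have h_coef : (Zᵀ * Z)⁻¹ *ᵥ (Zᵀ *ᵥ (Z *ᵥ γ)) = γ := by
    rw [mulVec_mulVec _ Zᵀ, mulVec_mulVec, nonsing_inv_mul _ hZ, one_mulVec]
  rw [olsResidual, olsResidual, mulVec_add, mulVec_add, h_coef, mulVec_add]
  abel

theorem olsResidual_dotProduct (Z : Matrix ι κ ℝ) (v y : ι → ℝ) :
    olsResidual Z v ⬝ᵥ y = v ⬝ᵥ y - (Zᵀ *ᵥ v) ⬝ᵥ ((Zᵀ * Z)⁻¹ *ᵥ (Zᵀ *ᵥ y)) := by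
  have h_symm : ((Zᵀ * Z)⁻¹)ᵀ = (Zᵀ * Z)⁻¹ := by
    rw [transpose_nonsing_inv, transpose_mul, transpose_transpose]
  rw [olsResidual, sub_dotProduct, dotProduct_comm (Z *ᵥ _), ← dotProduct_transpose_mulVec,
    dotProduct_comm ((Zᵀ * Z)⁻¹ *ᵥ _), ← dotProduct_transpose_mulVec, h_symm]

theorem olsResidual_dotProduct_olsResidual {Z : Matrix ι κ ℝ} (hZ : IsUnit (Zᵀ * Z).det)
    (v : ι → ℝ) : olsResidual Z v ⬝ᵥ olsResidual Z v = olsResidual Z v ⬝ᵥ v := by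
  have h_normal : Zᵀ *ᵥ olsResidual Z v = 0 := by
    rw [olsResidual, mulVec_sub, mulVec_mulVec _ Zᵀ, mulVec_mulVec _ (Zᵀ * Z),
      mul_nonsing_inv _ hZ, one_mulVec, sub_self]
  rw [olsResidual_dotProduct, h_normal, mulVec_zero, dotProduct_zero, sub_zero, dotProduct_comm]

theorem inv_smul_eq_inv_smul_inv (A : Matrix κ κ ℝ) {c : ℝ} (hc : c ≠ 0) :
    (c • A)⁻¹ = c⁻¹ • A⁻¹ := by
  by_cases hA : IsUnit A.det
  · exact Matrix.inv_smul' A (Units.mk0 c hc) hA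
  · have hcA : ¬ IsUnit (c • A).det := by simpa [det_smul, hc] using hA
    rw [nonsing_inv_apply_not_isUnit _ hA, nonsing_inv_apply_not_isUnit _ hcA, smul_zero]

theorem dotProduct_inv_mulVec_div (A : Matrix κ κ ℝ) (a b : κ → ℝ) (n : ℝ) :
    a ⬝ᵥ (A⁻¹ *ᵥ b) / n = (n⁻¹ • a) ⬝ᵥ ((n⁻¹ • A)⁻¹ *ᵥ (n⁻¹ • b)) := by
  rcases eq_or_ne n 0 with rfl | hn
  · simp
  · rw [inv_smul_eq_inv_smul_inv A (inv_ne_zero hn), inv_inv, smul_mulVec, mulVec_smul,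
      smul_inv_smul₀ hn, smul_dotProduct, smul_eq_mul, div_eq_inv_mul]

end Residuals

section Projection

variable {Ω : ℕ → Type*} [∀ S, MeasurableSpace (Ω S)] {P : ∀ S, Measure (Ω S)} {N : ℕ → ℕ} {p : ℕ}
  {Z : ∀ S, Ω S → Matrix (Fin (N S)) (Fin p) ℝ} {Q : Matrix (Fin p) (Fin p) ℝ}

theorem eventually_isUnit_det_of_tendsto (hQ : Q.det ≠ 0)
    (hZ : Tendsto (fun x : Σ S, Ω S => (N x.1 : ℝ)⁻¹ • ((Z x.1 x.2)ᵀ * Z x.1 x.2))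
      (highProb P) (𝓝 Q)) :
    ∀ᶠ x in highProb P, IsUnit ((Z x.1 x.2)ᵀ * Z x.1 x.2).det := by
  have h_det := ((continuous_id.matrix_det.tendsto Q).comp hZ).eventually_ne hQ
  filter_upwards [h_det] with x hx
  rw [isUnit_iff_ne_zero]
  contrapose! hx
  simp [hx]

theorem tendsto_olsResidual_dotProduct_div (hQ : Q.det ≠ 0)
    (hZ : Tendsto (fun x : Σ S, Ω S => (N x.1 : ℝ)⁻¹ • ((Z x.1 x.2)ᵀ * Z x.1 x.2))
      (highProb P) (𝓝 Q))
    {v y : ∀ S, Fin (N S) → Ω S → ℝ}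
    (hv : ∀ k, Tendsto (regionAvg ((fun S i ω => Z S ω i k) * v)) (highProb P) (𝓝 0))
    (hy : ∀ k, BddInProb P (regionAvg ((fun S i ω => Z S ω i k) * y))) :
    Tendsto (fun x : Σ S, Ω S =>
      olsResidual (Z x.1 x.2) (fun i => v x.1 i x.2) ⬝ᵥ (fun i => y x.1 i x.2) / N x.1 -
        regionAvg (v * y) x) (highProb P) (𝓝 0) := by
  have h_inv : Tendsto (fun x : Σ S, Ω S => ((N x.1 : ℝ)⁻¹ • ((Z x.1 x.2)ᵀ * Z x.1 x.2))⁻¹)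
      (highProb P) (𝓝 Q⁻¹) :=
    (continuousAt_matrix_inv Q (by simpa using continuousAt_inv₀ hQ)).tendsto.comp hZ
  have h_entry := fun k l => tendsto_pi_nhds.1 (tendsto_pi_nhds.1 h_inv k) l
  have h_term : ∀ l, Tendsto (fun x : Σ S, Ω S =>
      (∑ k, regionAvg ((fun S i ω => Z S ω i k) * v) x *
        ((N x.1 : ℝ)⁻¹ • ((Z x.1 x.2)ᵀ * Z x.1 x.2))⁻¹ k l) *
      regionAvg ((fun S i ω => Z S ω i l) * y) x) (highProb P) (𝓝 0) := fun l => by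
    have h_sum := tendsto_finsetSum Finset.univ fun k _ => (hv k).mul (h_entry k l)
    simp only [zero_mul, Finset.sum_const_zero] at h_sum
    exact (hy l).tendsto_mul_zero h_sum
  have h_lim := (tendsto_finsetSum Finset.univ fun l _ => h_term l).neg
  rw [Finset.sum_const_zero, neg_zero] at h_lim
  refine h_lim.congr fun x => ?_
  have h_avg : ∀ g : ∀ S, Fin (N S) → Ω S → ℝ,
      ((N x.1 : ℝ)⁻¹ • ((Z x.1 x.2)ᵀ *ᵥ fun i => g x.1 i x.2)) =
        fun k => regionAvg ((fun S i ω => Z S ω i k) * g) x := fun g => by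
    ext k
    simp [regionAvg_apply, mulVec, dotProduct, div_eq_inv_mul]
  rw [olsResidual_dotProduct, sub_div, dotProduct_inv_mulVec_div, h_avg, h_avg, dotProduct_mulVec]
  change _ = regionAvg (v * y) x - _ - _
  rw [sub_sub_cancel_left]
  rfl

end Projection

namespace ShiftShare

section SigmaFields

variable {S N p : ℕ} {Ω : Type*} [mΩ : MeasurableSpace Ω] (D : ShiftShare S N p Ω)

theorem sigmaW_le : D.sigmaW ≤ mΩ :=
  iSup₂_le fun i s => (D.measurable_w i s).comap_le

theorem F0_le : D.F0 ≤ mΩ := by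
  simp only [F0, sup_le_iff, iSup_le_iff]
  exact ⟨⟨⟨⟨fun s k => (D.measurable_ZZ s k).comap_le, fun i k => (D.measurable_U i k).comap_le⟩,
    fun i => (D.measurable_Y0 i).comap_le⟩, fun i s => (D.measurable_B i s).comap_le⟩, D.sigmaW_le⟩

theorem sigmaW_le_F0 : D.sigmaW ≤ D.F0 :=
  le_sup_right

theorem sigmaW_measurable_w (i : Fin N) (s : Fin S) : Measurable[D.sigmaW] (D.w i s) :=
  Measurable.of_comap_le <| le_iSup₂ (f := fun i s => MeasurableSpace.comap (D.w i s) _) i s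

theorem F0_measurable_w (i : Fin N) (s : Fin S) : Measurable[D.F0] (D.w i s) :=
  (D.sigmaW_measurable_w i s).mono D.sigmaW_le_F0 le_rfl

theorem F0_measurable_B (i : Fin N) (s : Fin S) : Measurable[D.F0] (D.B i s) :=
  Measurable.of_comap_le <|
    (le_iSup₂ (f := fun i s => MeasurableSpace.comap (D.B i s) _) i s).trans <|
      le_sup_right.trans le_sup_left

theorem F0_measurable_Y0 (i : Fin N) : Measurable[D.F0] (D.Y0 i) :=
  Measurable.of_comap_le <|
    (le_iSup (fun i => MeasurableSpace.comap (D.Y0 i) _) i).trans <|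
      le_sup_right.trans (le_sup_left.trans le_sup_left)

theorem F0_measurable_Z (i : Fin N) (k : Fin p) : Measurable[D.F0] fun ω => D.Z ω i k := by
  have hZZ : ∀ s, Measurable[D.F0] (D.ZZ s k) := fun s => Measurable.of_comap_le <|
    (le_iSup₂ (f := fun s k => MeasurableSpace.comap (D.ZZ s k) _) s k).trans <|
      le_sup_left.trans (le_sup_left.trans (le_sup_left.trans le_sup_left))
  have hU : Measurable[D.F0] (D.U i k) := Measurable.of_comap_le <|
    (le_iSup₂ (f := fun i k => MeasurableSpace.comap (D.U i k) _) i k).trans <|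
      le_sup_right.trans (le_sup_left.trans (le_sup_left.trans le_sup_left))
  exact (Finset.measurable_fun_sum (m := D.F0) _ fun s _ =>
    (D.F0_measurable_w i s).mul (hZZ s)).add hU

end SigmaFields

section Rows

variable {S N p : ℕ} {Ω : Type*} [MeasurableSpace Ω]

/-- The share-weighted aggregate `∑_s w_is x_s b_is` of the sector-level variables `x`. -/
def aggregate (D : ShiftShare S N p Ω) (x : Fin S → Ω → ℝ) (b : Fin N → Fin S → Ω → ℝ)
    (i : Fin N) (ω : Ω) : ℝ :=
  ∑ s, D.w i s ω * x s ω * b i s ω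

/-- The shock `X_s - E[X_s | F_0]` of a sector. -/
noncomputable def shock (D : ShiftShare S N p Ω) (P : Measure Ω) (s : Fin S) (ω : Ω) : ℝ :=
  D.XX s ω - (P[D.XX s | D.F0]) ω

/-- `∑_i ∑_s w_is² σ_s² b_is`, the numerator of the estimand when `b` are the effects. -/
noncomputable def weightedSum (D : ShiftShare S N p Ω) (P : Measure Ω)
    (b : Fin N → Fin S → Ω → ℝ) (ω : Ω) : ℝ :=
  ∑ i, ∑ s, D.w i s ω ^ 2 * D.condVariance P s ω * b i s ω

/-- The conditions on the shares and on the shifters under which averages of the regressor and of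
its products concentrate around their conditional means given `F_0`. -/
structure IsQuasiRandom (D : ShiftShare S N p Ω) (P : Measure Ω) (ν C : ℝ) : Prop where
  shares : ∀ᵐ ω ∂P, ∀ i, (∀ s, 0 ≤ D.w i s ω) ∧ ∑ s, D.w i s ω ≤ 1
  indep : CondIndepGiven D.F0 P D.XX
  moment : ∀ s, CondMeanLE D.F0 P (fun ω => |D.XX s ω| ^ (2 + ν)) C

theorem aggregate_shock (D : ShiftShare S N p Ω) (P : Measure Ω) (b : Fin N → Fin S → Ω → ℝ) :
    D.aggregate (D.shock P) b =
      D.aggregate D.XX b - D.aggregate (fun s => P[D.XX s | D.F0]) b := by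
  ext i ω
  simp only [aggregate, shock, Pi.sub_apply, mul_sub, sub_mul, Finset.sum_sub_distrib]

theorem sum_aggregate_mul (D : ShiftShare S N p Ω) (x : Fin S → Ω → ℝ) (g : Fin N → Ω → ℝ)
    (ω : Ω) :
    ∑ i, D.aggregate x 1 i ω * g i ω = ∑ s, (∑ i, D.w i s ω * g i ω) * x s ω := by
  simp only [aggregate, Pi.one_apply, mul_one, Finset.sum_mul]
  rw [Finset.sum_comm]
  exact Finset.sum_congr rfl fun s _ => Finset.sum_congr rfl fun i _ => mul_right_comm _ _ _

theorem sum_aggregate_mul_aggregate (D : ShiftShare S N p Ω) (x : Fin S → Ω → ℝ)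
    (b : Fin N → Fin S → Ω → ℝ) (ω : Ω) :
    ∑ i, D.aggregate x 1 i ω * D.aggregate x b i ω =
      ∑ s, ∑ t, (∑ i, D.w i s ω * D.w i t ω * b i t ω) * (x s ω * x t ω) := by
  rw [sum_aggregate_mul]
  refine Finset.sum_congr rfl fun s _ => ?_
  simp only [aggregate, Finset.mul_sum, Finset.sum_mul]
  rw [Finset.sum_comm]
  exact Finset.sum_congr rfl fun t _ => Finset.sum_congr rfl fun i _ => by ring

theorem weightedSum_eq (D : ShiftShare S N p Ω) (P : Measure Ω) (b : Fin N → Fin S → Ω → ℝ)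
    (ω : Ω) :
    D.weightedSum P b ω =
      ∑ s, (∑ i, D.w i s ω * D.w i s ω * b i s ω) * D.condVariance P s ω := by
  simp only [weightedSum, Finset.sum_mul]
  rw [Finset.sum_comm]
  exact Finset.sum_congr rfl fun s _ => Finset.sum_congr rfl fun i _ => by ring

theorem n_le_iSup (D : ShiftShare S N p Ω) (s : Fin S) (ω : Ω) : D.n s ω ≤ ⨆ s, D.n s ω :=
  le_ciSup (f := fun s => D.n s ω) (Set.finite_range _).bddAbove s

theorem iSup_n_nonneg {D : ShiftShare S N p Ω} {ω : Ω} (hw : ∀ i s, 0 ≤ D.w i s ω) :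
    0 ≤ ⨆ s, D.n s ω :=
  Real.iSup_nonneg fun s => Finset.sum_nonneg fun i _ => hw i s

variable {D : ShiftShare S N p Ω} {P : Measure Ω}

theorem integrable_weightedSum (hw : ∀ᵐ ω ∂P, ∀ i, (∀ s, 0 ≤ D.w i s ω) ∧ ∑ s, D.w i s ω ≤ 1)
    {b : Fin N → Fin S → Ω → ℝ} (hb_meas : ∀ i s, Measurable (b i s)) {K : ℝ}
    (hb : ∀ᵐ ω ∂P, ∀ i s, |b i s ω| ≤ K) : Integrable (D.weightedSum P b) P := by
  refine integrable_finsetSum _ fun i _ => integrable_finsetSum _ fun s _ => ?_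
  have h_var : Integrable (D.condVariance P s) P := integrable_condVar
  refine (h_var.bdd_mul (c := K) (f := fun ω => D.w i s ω ^ 2 * b i s ω)
    (((D.measurable_w i s).pow_const 2).mul (hb_meas i s)).aestronglyMeasurable ?_).congr
      (.of_forall fun ω => by ring)
  filter_upwards [hw, hb] with ω hwω hbω
  have h_le_one : D.w i s ω ≤ 1 :=
    (Finset.single_le_sum (fun t _ => (hwω i).1 t) (Finset.mem_univ s)).trans (hwω i).2
  rw [Real.norm_eq_abs, abs_mul, abs_of_nonneg (sq_nonneg _)]
  exact (mul_le_of_le_one_left (abs_nonneg _) (pow_le_one₀ ((hwω i).1 s) h_le_one)).trans (hbω i s)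

variable [IsProbabilityMeasure P] {ν C : ℝ}

theorem condExp_abs_avg_shock_mul_le (hD : D.IsQuasiRandom P ν C) (hν : 0 ≤ ν) (hC : 0 ≤ C)
    {g : Fin N → Ω → ℝ} (hg : ∀ i, Measurable[D.F0] (g i))
    (h_int : Integrable (fun ω => (∑ i, D.aggregate (D.shock P) 1 i ω * g i ω) / N) P) :
    P[fun ω => |(∑ i, D.aggregate (D.shock P) 1 i ω * g i ω) / N| | D.F0] ≤ᵐ[P] fun ω =>
      √((1 + C) * ((⨆ s, D.n s ω) / N * ((∑ i, g i ω ^ 2) / N))) := by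
  have h_linear : ∀ ω, (∑ i, D.aggregate (D.shock P) 1 i ω * g i ω) / N =
      ∑ s, (∑ i, D.w i s ω * g i ω) / N * (D.XX s ω - (P[D.XX s | D.F0]) ω) := fun ω => by
    rw [sum_aggregate_mul, Finset.sum_div]
    exact Finset.sum_congr rfl fun s _ => mul_div_right_comm _ _ _
  simp only [h_linear] at h_int ⊢
  have h_meas : ∀ s, Measurable[D.F0] fun ω => (∑ i, D.w i s ω * g i ω) / N := fun s =>
    (Finset.measurable_fun_sum (m := D.F0) _ fun i _ =>
      (D.F0_measurable_w i s).mul (hg i)).div_const _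
  filter_upwards [condExp_abs_sum_mul_sub_condExp_le D.F0_le D.measurable_XX hD.indep hν hD.moment
    h_meas h_int, hD.shares] with ω h_bound hw
  refine h_bound.trans (Real.sqrt_le_sqrt ?_)
  gcongr
  calc ∑ s, ((∑ i, D.w i s ω * g i ω) / N) ^ 2
      = (∑ s, (∑ i, D.w i s ω * g i ω) ^ 2) / N ^ 2 := by simp only [div_pow, ← Finset.sum_div]
    _ ≤ (⨆ s, D.n s ω) * (∑ i, g i ω ^ 2) / N ^ 2 := by
        gcongr
        exact sum_sq_sum_mul_le (fun i => (hw i).1) (fun i => (hw i).2)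
          (fun s => D.n_le_iSup s ω) (iSup_n_nonneg fun i => (hw i).1) _
    _ = (⨆ s, D.n s ω) / N * ((∑ i, g i ω ^ 2) / N) := by rw [sq, mul_div_mul_comm]

theorem condExp_abs_avg_shock_mul_shock_sub_le (hD : D.IsQuasiRandom P ν C) (hν : 0 ≤ ν)
    (hC : 0 ≤ C) {b : Fin N → Fin S → Ω → ℝ} (hb_meas : ∀ i s, Measurable[D.F0] (b i s)) {K : ℝ}
    (hK : 0 ≤ K) (hb : ∀ᵐ ω ∂P, ∀ i s, |b i s ω| ≤ K)
    (h_int : Integrable (fun ω =>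
      (∑ i, D.aggregate (D.shock P) 1 i ω * D.aggregate (D.shock P) b i ω) / N -
        D.weightedSum P b ω / N) P) {R : ℝ} (hR : 0 < R) :
    P[fun ω => |(∑ i, D.aggregate (D.shock P) 1 i ω * D.aggregate (D.shock P) b i ω) / N -
        D.weightedSum P b ω / N| | D.F0] ≤ᵐ[P] fun ω =>
      (2 * (1 + C) + R ^ 2) * √(K ^ 2 * ((⨆ s, D.n s ω) / N)) +
        2 * (2 ^ (2 + ν) * C / R ^ ν * K) := by
  let M : Fin S → Fin S → Ω → ℝ := fun s t ω => (∑ i, D.w i s ω * D.w i t ω * b i t ω) / N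
  have h_quadratic : ∀ ω,
      (∑ i, D.aggregate (D.shock P) 1 i ω * D.aggregate (D.shock P) b i ω) / N -
        D.weightedSum P b ω / N =
      ∑ s, ∑ t, M s t ω * ((D.XX s ω - (P[D.XX s | D.F0]) ω) *
          (D.XX t ω - (P[D.XX t | D.F0]) ω)) -
        ∑ s, M s s ω * (Var[D.XX s; P | D.F0]) ω := fun ω => by
    simp only [sum_aggregate_mul_aggregate, weightedSum_eq, M, Finset.sum_div, mul_div_right_comm]
    rfl
  simp only [h_quadratic] at h_int ⊢
  have hM : ∀ s t, Measurable[D.F0] (M s t) := fun s t =>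
    (Finset.measurable_fun_sum (m := D.F0) _ fun i _ =>
      ((D.F0_measurable_w i s).mul (D.F0_measurable_w i t)).mul (hb_meas i t)).div_const _
  filter_upwards [condExp_abs_quadratic_sub_condVar_le D.F0_le D.measurable_XX hD.indep hν hC
    hD.moment hM h_int hR, hD.shares, hb] with ω h_bound hw hbω
  refine h_bound.trans ?_
  have h_frobenius : ∑ s, ∑ t, M s t ω ^ 2 ≤ K ^ 2 * ((⨆ s, D.n s ω) / N) := by
    have h_sum := sum_sum_sq_sum_mul_mul_le (fun i => (hw i).1) (fun i => (hw i).2)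
      (fun s => D.n_le_iSup s ω) (iSup_n_nonneg fun i => (hw i).1) hbω
    rw [Fintype.card_fin] at h_sum
    calc ∑ s, ∑ t, M s t ω ^ 2
        = (∑ s, ∑ t, (∑ i, D.w i s ω * D.w i t ω * b i t ω) ^ 2) / N ^ 2 := by
          simp only [M, div_pow, ← Finset.sum_div]
      _ ≤ K ^ 2 * ((⨆ s, D.n s ω) * N) / N ^ 2 := by gcongr
      _ = K ^ 2 * ((⨆ s, D.n s ω) / N) := by
          rcases eq_or_ne (N : ℝ) 0 with hN | hN
          · simp [hN]
          · field_simp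
  have h_trace : ∑ s, |M s s ω| ≤ K := by
    have h_sum := sum_abs_sum_mul_mul_self_le (fun i => (hw i).1) (fun i => (hw i).2) hbω hK
    rw [Fintype.card_fin] at h_sum
    simp only [M, abs_div, Nat.abs_cast, ← Finset.sum_div]
    exact div_le_of_le_mul₀ N.cast_nonneg hK h_sum
  gcongr

end Rows

section Arrays

variable {Ω : ℕ → Type*} {m : ∀ S, MeasurableSpace (Ω S)} [mΩ : ∀ S, MeasurableSpace (Ω S)]
  {P : ∀ S, Measure (Ω S)} {N : ℕ → ℕ} {p : ℕ}
  {D : ∀ S, ShiftShare S (N S) p (Ω S)} {ν C K : ℝ} {b : ∀ S, Fin (N S) → Fin S → Ω S → ℝ}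

/-- The array of the exposures `∑_s w_is (X_s - E[X_s | F_0]) b_is` of the regions to the shocks. -/
noncomputable def exposure (D : ∀ S, ShiftShare S (N S) p (Ω S)) (P : ∀ S, Measure (Ω S))
    (b : ∀ S, Fin (N S) → Fin S → Ω S → ℝ) : ∀ S, Fin (N S) → Ω S → ℝ :=
  fun S => (D S).aggregate ((D S).shock (P S)) (b S)

variable [∀ S, IsProbabilityMeasure (P S)]

theorem aggregate_mem_unifL2 (hm : ∀ S, m S ≤ mΩ S)
    (hWm : ∀ S, (D S).sigmaW ≤ m S)
    (hw : ∀ S, ∀ᵐ ω ∂P S, ∀ i, (∀ s, 0 ≤ (D S).w i s ω) ∧ ∑ s, (D S).w i s ω ≤ 1)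
    {x : ∀ S, Fin S → Ω S → ℝ} (hx : ∀ S s, AEStronglyMeasurable (x S s) (P S))
    (hC : ∀ S s, CondMeanLE (m S) (P S) (fun ω => x S s ω ^ 2) C)
    (hb_meas : ∀ S i s, Measurable (b S i s)) (hb : ∀ S, ∀ᵐ ω ∂P S, ∀ i s, |b S i s ω| ≤ K) :
    (fun S => (D S).aggregate (x S) (b S)) ∈ unifL2 P N :=
  ⟨K ^ 2 * |C|, fun S i => memLp_two_sum_mul_mul_of_condMeanLE (hm S)
    (fun s => ((D S).sigmaW_measurable_w i s).mono (hWm S) le_rfl) ((hw S).mono fun _ h => h i)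
    (hx S) (hC S) (fun s => (hb_meas S i s).aestronglyMeasurable) ((hb S).mono fun _ h => h i)⟩

theorem aggregate_XX_mem_unifL2 (hD : ∀ S, (D S).IsQuasiRandom (P S) ν C) (hν : 0 ≤ ν)
    (hb_meas : ∀ S i s, Measurable (b S i s)) (hb : ∀ S, ∀ᵐ ω ∂P S, ∀ i s, |b S i s ω| ≤ K) :
    (fun S => (D S).aggregate (D S).XX (b S)) ∈ unifL2 P N :=
  aggregate_mem_unifL2 (fun S => (D S).F0_le) (fun S => (D S).sigmaW_le_F0)
    (fun S => (hD S).shares) (fun S s => ((D S).measurable_XX s).aestronglyMeasurable)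
    (fun S s => .sq_of_abs_rpow (D S).F0_le ((D S).measurable_XX s).aestronglyMeasurable hν
      ((hD S).moment s)) hb_meas hb

theorem aggregate_condExp_mem_unifL2 (hD : ∀ S, (D S).IsQuasiRandom (P S) ν C) (hν : 0 ≤ ν)
    (hb_meas : ∀ S i s, Measurable (b S i s)) (hb : ∀ S, ∀ᵐ ω ∂P S, ∀ i s, |b S i s ω| ≤ K) :
    (fun S => (D S).aggregate (fun s => (P S)[(D S).XX s | (D S).F0]) (b S)) ∈ unifL2 P N := by
  refine aggregate_mem_unifL2 (C := 1 + C) (fun S => (D S).F0_le) (fun S => (D S).sigmaW_le_F0)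
    (fun S => (hD S).shares) (fun S s => integrable_condExp.aestronglyMeasurable)
    (fun S s => ?_) hb_meas hb
  have hX := ((D S).measurable_XX s).aestronglyMeasurable (μ := P S)
  exact .sq_condExp (D S).F0_le (memLp_two_of_integrable_abs_rpow hX hν ((hD S).moment s).1)
    (.sq_of_abs_rpow (D S).F0_le hX hν ((hD S).moment s))

theorem exposure_mem_unifL2 (hD : ∀ S, (D S).IsQuasiRandom (P S) ν C) (hν : 0 ≤ ν)
    (hb_meas : ∀ S i s, Measurable (b S i s)) (hb : ∀ S, ∀ᵐ ω ∂P S, ∀ i s, |b S i s ω| ≤ K) :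
    exposure D P b ∈ unifL2 P N := by
  have h_eq : exposure D P b = (fun S => (D S).aggregate (D S).XX (b S)) -
      fun S => (D S).aggregate (fun s => (P S)[(D S).XX s | (D S).F0]) (b S) :=
    funext fun S => (D S).aggregate_shock (P S) (b S)
  rw [h_eq]
  exact Submodule.sub_mem _ (aggregate_XX_mem_unifL2 hD hν hb_meas hb)
    (aggregate_condExp_mem_unifL2 hD hν hb_meas hb)

theorem exposure_one_mem_unifL2 (hD : ∀ S, (D S).IsQuasiRandom (P S) ν C) (hν : 0 ≤ ν) :
    exposure D P 1 ∈ unifL2 P N :=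
  exposure_mem_unifL2 (K := 1) hD hν (fun _ _ _ => measurable_const) fun S => .of_forall (by simp)

theorem tendsto_regionAvg_exposure_mul (hD : ∀ S, (D S).IsQuasiRandom (P S) ν C) (hν : 0 ≤ ν)
    (hC : 0 ≤ C)
    (h_size : Tendsto (fun x : Σ S, Ω S => (⨆ s, (D x.1).n s x.2) / N x.1) (highProb P) (𝓝 0))
    {g : ∀ S, Fin (N S) → Ω S → ℝ} (hg : g ∈ unifL2 P N)
    (hg_meas : ∀ S i, Measurable[(D S).F0] (g S i)) :
    Tendsto (regionAvg (exposure D P 1 * g)) (highProb P) (𝓝 0) := by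
  obtain ⟨_, hA_mem⟩ := exposure_one_mem_unifL2 hD hν
  have ⟨_, hg_mem⟩ := hg
  have h_int : ∀ S, Integrable (fun ω => regionAvg (exposure D P 1 * g) ⟨S, ω⟩) (P S) :=
    integrable_regionAvg_mul (fun S i => (hA_mem S i).1) (fun S i => (hg_mem S i).1)
  have h_bound : Tendsto (fun x : Σ S, Ω S =>
      √((1 + C) * ((⨆ s, (D x.1).n s x.2) / N x.1 * regionAvg (g * g) x))) (highProb P) (𝓝 0) := by
    simpa using (((bddInProb_regionAvg_mul hg hg).tendsto_mul_zero h_size).const_mul (1 + C)).sqrt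
  have h_cond : ∀ᶠ x : Σ S, Ω S in highProb P,
      ((P x.1)[fun ω => |regionAvg (exposure D P 1 * g) ⟨x.1, ω⟩| | (D x.1).F0]) x.2 ≤
        √((1 + C) * ((⨆ s, (D x.1).n s x.2) / N x.1 * ((∑ i, g x.1 i x.2 ^ 2) / N x.1))) :=
    eventually_highProb_of_ae fun S =>
      condExp_abs_avg_shock_mul_le (g := g S) (hD S) hν hC (hg_meas S) (h_int S)
  refine tendsto_highProb_zero_of_condExp_abs (fun S => (D S).F0_le) h_int fun η hη => ?_
  filter_upwards [h_bound.eventually_le_const hη, h_cond] with x hx h_le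
  simp only [regionAvg_apply, ← sq] at hx
  exact h_le.trans hx

theorem tendsto_regionAvg_exposure_mul_exposure (hD : ∀ S, (D S).IsQuasiRandom (P S) ν C)
    (hν : 0 < ν) (hC : 0 ≤ C)
    (h_size : Tendsto (fun x : Σ S, Ω S => (⨆ s, (D x.1).n s x.2) / N x.1) (highProb P) (𝓝 0))
    (hb_meas : ∀ S i s, Measurable[(D S).F0] (b S i s)) (hK : 0 ≤ K)
    (hb : ∀ S, ∀ᵐ ω ∂P S, ∀ i s, |b S i s ω| ≤ K) :
    Tendsto (fun x => regionAvg (exposure D P 1 * exposure D P b) x -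
      (D x.1).weightedSum (P x.1) (b x.1) x.2 / N x.1) (highProb P) (𝓝 0) := by
  have hA := exposure_one_mem_unifL2 hD hν.le
  have hB := exposure_mem_unifL2 hD hν.le (fun S i s => (hb_meas S i s).mono (D S).F0_le le_rfl) hb
  obtain ⟨_, hA_mem⟩ := hA
  obtain ⟨_, hB_mem⟩ := hB
  have h_int : ∀ S, Integrable (fun ω => regionAvg (exposure D P 1 * exposure D P b) ⟨S, ω⟩ -
      (D S).weightedSum (P S) (b S) ω / N S) (P S) := fun S =>
    (integrable_regionAvg_mul (fun S i => (hA_mem S i).1) (fun S i => (hB_mem S i).1) S).sub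
      ((integrable_weightedSum (hD S).shares
        (fun i s => (hb_meas S i s).mono (D S).F0_le le_rfl) (hb S)).div_const _)
  have h_truncation : Tendsto (fun R : ℝ => 2 * (2 ^ (2 + ν) * C / R ^ ν * K)) atTop (𝓝 0) := by
    simpa using (((tendsto_rpow_atTop hν).const_div_atTop _).mul_const K).const_mul 2
  refine tendsto_highProb_zero_of_condExp_abs (fun S => (D S).F0_le) h_int fun η hη => ?_
  obtain ⟨R, hR, hR_pos⟩ := ((h_truncation.eventually_le_const (half_pos hη)).and
    (eventually_gt_atTop 0)).exists
  have h_size_R : Tendsto (fun x : Σ S, Ω S => (2 * (1 + C) + R ^ 2) *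
      √(K ^ 2 * ((⨆ s, (D x.1).n s x.2) / N x.1))) (highProb P) (𝓝 0) := by
    simpa using (h_size.const_mul (K ^ 2)).sqrt.const_mul (2 * (1 + C) + R ^ 2)
  have h_cond : ∀ᶠ x : Σ S, Ω S in highProb P,
      ((P x.1)[fun ω => |regionAvg (exposure D P 1 * exposure D P b) ⟨x.1, ω⟩ -
        (D x.1).weightedSum (P x.1) (b x.1) ω / N x.1| | (D x.1).F0]) x.2 ≤
        (2 * (1 + C) + R ^ 2) * √(K ^ 2 * ((⨆ s, (D x.1).n s x.2) / N x.1)) +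
          2 * (2 ^ (2 + ν) * C / R ^ ν * K) :=
    eventually_highProb_of_ae fun S => condExp_abs_avg_shock_mul_shock_sub_le (hD S) hν.le hC
      (hb_meas S) hK (hb S) (h_int S) hR_pos
  filter_upwards [h_size_R.eventually_le_const (half_pos hη), h_cond] with x hx h_le
  linarith

end Arrays

end ShiftShare

theorem tendsto_div_sub_div_of_abs_le {α : Type*} {l : Filter α} {a a' b b' n : α → ℝ} {c K : ℝ}
    (hc : c ≠ 0) (ha : Tendsto (fun x => a x / n x - a' x / n x) l (𝓝 0))
    (hb : Tendsto (fun x => b x / n x) l (𝓝 c)) (hb' : Tendsto (fun x => b' x / n x) l (𝓝 c))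
    (h_bdd : ∀ᶠ x in l, |a' x / b' x| ≤ K) :
    Tendsto (fun x => a x / b x - a' x / b' x) l (𝓝 0) := by
  have h_first : Tendsto (fun x => (a x / n x - a' x / n x) / (b x / n x)) l (𝓝 0) :=
    zero_div c ▸ ha.div hb hc
  have h_ratio : Tendsto (fun x => (b' x / n x) / (b x / n x) - 1) l (𝓝 0) := by
    have h_one := (hb'.div hb hc).sub_const 1
    rwa [div_self hc, sub_self] at h_one
  have h_lim := h_first.add (bdd_le_mul_tendsto_zero' K h_bdd h_ratio)
  rw [add_zero] at h_lim
  refine h_lim.congr' ?_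
  filter_upwards [hb.eventually_ne hc, hb'.eventually_ne hc] with x hbx hbx'
  obtain ⟨hb_ne, hn⟩ := div_ne_zero_iff.1 hbx
  have hb_ne' := (div_ne_zero_iff.1 hbx').1
  field_simp
  ring

namespace ShiftShare

section Regression

variable {S N p : ℕ} {Ω : Type*} [MeasurableSpace Ω] {D : ShiftShare S N p Ω}

/-- The measurement error `U_i'γ` in the controls that matter. -/
def controlError (D : ShiftShare S N p Ω) (γ : Fin p → ℝ) (i : Fin N) (ω : Ω) : ℝ :=
  ∑ k, D.U i k ω * γ k

theorem X_eq_sub_controlError_add (P : Measure Ω) {γ : Fin p → ℝ} {ω : Ω}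
    (h : ∀ s, (P[D.XX s | D.F0]) ω = ∑ k, D.ZZ s k ω * γ k) :
    D.X ω = (fun i => D.aggregate (D.shock P) 1 i ω - D.controlError γ i ω) + D.Z ω *ᵥ γ := by
  ext i
  have h_mean : ∑ s, D.w i s ω * (P[D.XX s | D.F0]) ω =
      ∑ k, (∑ s, D.w i s ω * D.ZZ s k ω) * γ k := by
    simp only [h, Finset.mul_sum, Finset.sum_mul, mul_assoc]
    exact Finset.sum_comm
  simp only [X, aggregate, shock, controlError, Z, mulVec, dotProduct, Pi.add_apply, Pi.one_apply,
    of_apply, mul_one, mul_sub, add_mul, Finset.sum_sub_distrib, Finset.sum_add_distrib, h_mean]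
  ring

theorem Xres_eq (D : ShiftShare S N p Ω) (ω : Ω) :
    D.Xres ω = olsResidual (D.Z ω) (D.X ω) :=
  rfl

theorem Y_apply (D : ShiftShare S N p Ω) (ω : Ω) (i : Fin N) :
    D.Y ω i = D.Y0 i ω + D.aggregate D.XX D.B i ω + D.L i ω :=
  rfl

theorem weightedSum_one (D : ShiftShare S N p Ω) (P : Measure Ω) :
    D.weightedSum P 1 = D.totalWeight P := by
  ext ω
  simp [weightedSum, totalWeight]

theorem abs_betaBar_le {P : Measure Ω} {K : ℝ} (hK : 0 ≤ K)
    (hB : ∀ᵐ ω ∂P, ∀ i s, |D.B i s ω| ≤ K) : ∀ᵐ ω ∂P, |D.betaBar P ω| ≤ K := by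
  have h_var : ∀ᵐ ω ∂P, ∀ s, 0 ≤ D.condVariance P s ω :=
    ae_all_iff.2 fun s => condExp_nonneg (.of_forall fun ω => sq_nonneg _)
  filter_upwards [h_var, hB] with ω hv hBω
  have h_weight : ∀ i s, 0 ≤ D.w i s ω ^ 2 * D.condVariance P s ω := fun i s =>
    mul_nonneg (sq_nonneg _) (hv s)
  have h_total : 0 ≤ D.totalWeight P ω :=
    Finset.sum_nonneg fun i _ => Finset.sum_nonneg fun s _ => h_weight i s
  rw [betaBar, abs_div, abs_of_nonneg h_total]
  refine div_le_of_le_mul₀ h_total hK ?_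
  rw [totalWeight, Finset.mul_sum]
  refine (Finset.abs_sum_le_sum_abs _ _).trans <| Finset.sum_le_sum fun i _ => ?_
  rw [Finset.mul_sum]
  refine (Finset.abs_sum_le_sum_abs _ _).trans <| Finset.sum_le_sum fun s _ => ?_
  rw [abs_mul, abs_of_nonneg (h_weight i s), mul_comm K]
  exact mul_le_mul_of_nonneg_left (hBω i s) (h_weight i s)

theorem betaBar_eq {P : Measure Ω} {ω : Ω} {b : ℝ} (hB : ∀ i s, D.B i s ω = b)
    (h : D.totalWeight P ω ≠ 0) : D.betaBar P ω = b := by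
  simp only [betaBar, hB, ← Finset.sum_mul]
  exact mul_div_cancel_left₀ b h

end Regression

section Regularity

variable {Ω : ℕ → Type*} [mΩ : ∀ S, MeasurableSpace (Ω S)] {P : ∀ S, Measure (Ω S)} {N : ℕ → ℕ}
  {p : ℕ} {D : ∀ S, ShiftShare S (N S) p (Ω S)} {γ : Fin p → ℝ} {Q : Matrix (Fin p) (Fin p) ℝ}
  {c ν C K : ℝ} {b : ∀ S, Fin (N S) → Fin S → Ω S → ℝ} {f : ∀ S, Fin (N S) → Ω S → ℝ}

/-- The assumptions of the consistency theorem on the triangular array, with the bounds on the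
moments of the shifters and on the effects named. -/
structure IsRegular (D : ∀ S, ShiftShare S (N S) p (Ω S)) (P : ∀ S, Measure (Ω S))
    (γ : Fin p → ℝ) (Q : Matrix (Fin p) (Fin p) ℝ) (c ν C K : ℝ) : Prop where
  c_pos : 0 < c
  ν_pos : 0 < ν
  C_nonneg : 0 ≤ C
  K_nonneg : 0 ≤ K
  quasiRandom : ∀ S, (D S).IsQuasiRandom (P S) ν C
  assign : ∀ S, ∀ᵐ ω ∂P S, ∀ s, ((P S)[(D S).XX s | (D S).F0]) ω = ∑ k, (D S).ZZ s k ω * γ k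
  size : ConvInProb P (fun S ω => (⨆ s, (D S).n s ω) / N S) 0
  abs_B_le : ∀ S, ∀ᵐ ω ∂P S, ∀ i s, |(D S).B i s ω| ≤ K
  Y0_moment : ∃ C, ∀ S i, CondMeanLE (D S).sigmaW (P S) (fun ω => (D S).Y0 i ω ^ 2) C
  U_moment : ∃ C, ∀ S i k, CondMeanLE (D S).sigmaW (P S) (fun ω => (D S).U i k ω ^ 2) C
  ZZ_moment : ∃ C, ∀ S s k, CondMeanLE (D S).sigmaW (P S) (fun ω => (D S).ZZ s k ω ^ 2) C
  controlError_sq : Tendsto (fun S => (∑ i, ∫ ω, (D S).controlError γ i ω ^ 2 ∂P S) / N S) atTop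
    (𝓝 0)
  L_sq_integrable : ∀ S i, Integrable (fun ω => (D S).L i ω ^ 2) (P S)
  L_rms : Tendsto (fun S => (∑ i, √(∫ ω, (D S).L i ω ^ 2 ∂P S)) / N S) atTop (𝓝 0)
  variance : ConvInProb P (fun S ω => (D S).totalWeight (P S) ω / N S) c
  det_ne_zero : Q.det ≠ 0
  gram : ∀ k l, ConvInProb P (fun S ω => (((D S).Z ω)ᵀ * (D S).Z ω) k l / N S) (Q k l)

/-- The part `∑_s w_is (X_s - E[X_s | F_0]) - U_i'γ` of the regressor that remains after the
linear combination `Z_i'γ` of the controls has been removed. -/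
noncomputable def innovation (D : ∀ S, ShiftShare S (N S) p (Ω S)) (P : ∀ S, Measure (Ω S))
    (γ : Fin p → ℝ) : ∀ S, Fin (N S) → Ω S → ℝ :=
  exposure D P 1 - fun S => (D S).controlError γ

theorem Y_eq_add_exposure : (fun S i ω => (D S).Y ω i) = ((fun S => (D S).Y0) +
    fun S => (D S).aggregate (fun s => (P S)[(D S).XX s | (D S).F0]) (D S).B) +
      exposure D P (fun S => (D S).B) + fun S => (D S).L := by
  funext S i ω
  have h_split := congrFun₂ ((D S).aggregate_shock (P S) (D S).B) i ω
  simp only [Pi.sub_apply, Pi.add_apply, exposure, Y_apply] at h_split ⊢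
  linarith

namespace IsRegular

theorem tendsto_size (hD : IsRegular D P γ Q c ν C K) :
    Tendsto (fun x : Σ S, Ω S => (⨆ s, (D x.1).n s x.2) / N x.1) (highProb P) (𝓝 0) :=
  (convInProb_iff_tendsto_highProb.1 hD.size :)

theorem tendsto_totalWeight_div (hD : IsRegular D P γ Q c ν C K) : Tendsto
    (fun x : Σ S, Ω S => (D x.1).totalWeight (P x.1) x.2 / N x.1) (highProb P) (𝓝 c) :=
  (convInProb_iff_tendsto_highProb.1 hD.variance :)

theorem tendsto_gram (hD : IsRegular D P γ Q c ν C K) :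
    Tendsto (fun x : Σ S, Ω S => (N x.1 : ℝ)⁻¹ • (((D x.1).Z x.2)ᵀ * (D x.1).Z x.2))
      (highProb P) (𝓝 Q) := by
  refine tendsto_pi_nhds.2 fun k => tendsto_pi_nhds.2 fun l => ?_
  simpa only [Matrix.smul_apply, smul_eq_mul, div_eq_inv_mul] using
    convInProb_iff_tendsto_highProb.1 (hD.gram k l)

theorem eventually_Xres_eq (hD : IsRegular D P γ Q c ν C K) : ∀ᶠ x : Σ S, Ω S in highProb P,
    IsUnit (((D x.1).Z x.2)ᵀ * (D x.1).Z x.2).det ∧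
      (D x.1).Xres x.2 = olsResidual ((D x.1).Z x.2) fun i => innovation D P γ x.1 i x.2 := by
  have h_X : ∀ᶠ x : Σ S, Ω S in highProb P, (D x.1).X x.2 =
      (fun i => innovation D P γ x.1 i x.2) + (D x.1).Z x.2 *ᵥ γ :=
    eventually_highProb_of_ae fun S => (hD.assign S).mono fun ω h => X_eq_sub_controlError_add _ h
  have h_det := eventually_isUnit_det_of_tendsto (Z := fun S => (D S).Z) hD.det_ne_zero
    hD.tendsto_gram
  filter_upwards [h_det, h_X] with x hZ hX
  refine ⟨hZ, ?_⟩
  rw [Xres_eq, hX, olsResidual_add_mulVec hZ]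

theorem L_negligible (hD : IsRegular D P γ Q c ν C K) : IsNegligible P fun S => (D S).L :=
  ⟨fun S i => (memLp_two_iff_integrable_sq
    ((D S).measurable_Lfun i).aestronglyMeasurable).2 (hD.L_sq_integrable S i), hD.L_rms⟩

theorem eventually_betaBar_eq (hD : IsRegular D P γ Q c ν C K) {β : ℕ → ℝ}
    (hB : ∀ S i s, ∀ᵐ ω ∂P S, (D S).B i s ω = β S) :
    ∀ᶠ x : Σ S, Ω S in highProb P, (D x.1).betaBar (P x.1) x.2 = β x.1 := by
  have hB_ae : ∀ᶠ x : Σ S, Ω S in highProb P, ∀ i s, (D x.1).B i s x.2 = β x.1 :=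
    eventually_highProb_of_ae fun S => ae_all_iff.2 fun i => ae_all_iff.2 fun s => hB S i s
  filter_upwards [hD.tendsto_totalWeight_div.eventually_ne hD.c_pos.ne', hB_ae] with x hT hBx
  exact betaBar_eq hBx (div_ne_zero_iff.1 hT).1

variable [∀ S, IsProbabilityMeasure (P S)]

theorem Y0_mem (hD : IsRegular D P γ Q c ν C K) : (fun S => (D S).Y0) ∈ unifL2 P N :=
  mem_unifL2_of_condMeanLE (fun S => (D S).sigmaW_le)
    (fun S i => ((D S).measurable_Y0 i).aestronglyMeasurable) hD.Y0_moment

theorem U_mem (hD : IsRegular D P γ Q c ν C K) (k : Fin p) :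
    (fun S i => (D S).U i k) ∈ unifL2 P N :=
  mem_unifL2_of_condMeanLE (fun S => (D S).sigmaW_le)
    (fun S i => ((D S).measurable_U i k).aestronglyMeasurable) <|
      hD.U_moment.imp fun _ hU S i => hU S i k

theorem Z_mem (hD : IsRegular D P γ Q c ν C K) (k : Fin p) :
    (fun S i ω => (D S).Z ω i k) ∈ unifL2 P N := by
  obtain ⟨R, hR⟩ := hD.ZZ_moment
  have h_agg : (fun S => (D S).aggregate (fun s => (D S).ZZ s k) 1) ∈ unifL2 P N :=
    aggregate_mem_unifL2 (b := 1) (K := 1) (fun S => (D S).sigmaW_le) (fun S => le_rfl)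
      (fun S => (hD.quasiRandom S).shares)
      (fun S s => ((D S).measurable_ZZ s k).aestronglyMeasurable) (fun S s => hR S s k)
      (fun _ _ _ => measurable_const) fun S => .of_forall (by simp)
  convert Submodule.add_mem _ h_agg (hD.U_mem k) using 1
  ext S i ω
  simp [Z, aggregate]

theorem controlError_mem (hD : IsRegular D P γ Q c ν C K) :
    (fun S => (D S).controlError γ) ∈ unifL2 P N := by
  have h_sum := Submodule.sum_mem (unifL2 P N) fun k (_ : k ∈ Finset.univ) =>
    Submodule.smul_mem _ (γ k) (hD.U_mem k)
  convert h_sum using 1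
  ext S i ω
  simp [controlError, Finset.sum_apply, mul_comm]

theorem controlError_negligible (hD : IsRegular D P γ Q c ν C K) :
    IsNegligible P fun S => (D S).controlError γ := by
  obtain ⟨R, hR⟩ := hD.controlError_mem
  exact .of_sum_integral_sq (fun S i => (hR S i).1) hD.controlError_sq

theorem innovation_mem (hD : IsRegular D P γ Q c ν C K) : innovation D P γ ∈ unifL2 P N :=
  Submodule.sub_mem _ (exposure_one_mem_unifL2 hD.quasiRandom hD.ν_pos.le) hD.controlError_mem

theorem tendsto_regionAvg_innovation_mul_zero (hD : IsRegular D P γ Q c ν C K) (hf : f ∈ unifL2 P N)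
    (hf_meas : ∀ S i, Measurable[(D S).F0] (f S i)) :
    Tendsto (regionAvg (innovation D P γ * f)) (highProb P) (𝓝 0) := by
  have h_exposure := tendsto_regionAvg_exposure_mul hD.quasiRandom hD.ν_pos.le hD.C_nonneg
    hD.tendsto_size hf hf_meas
  have h_lim := h_exposure.sub (tendsto_regionAvg_mul_zero hf hD.controlError_negligible)
  rw [sub_zero] at h_lim
  refine h_lim.congr fun x => ?_
  rw [innovation, sub_mul, map_sub, mul_comm f, Pi.sub_apply]

theorem tendsto_regionAvg_innovation_mul_exposure_sub (hD : IsRegular D P γ Q c ν C K)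
    (hb_meas : ∀ S i s, Measurable[(D S).F0] (b S i s)) {R : ℝ} (hR : 0 ≤ R)
    (hb : ∀ S, ∀ᵐ ω ∂P S, ∀ i s, |b S i s ω| ≤ R) :
    Tendsto (fun x => regionAvg (innovation D P γ * exposure D P b) x -
      (D x.1).weightedSum (P x.1) (b x.1) x.2 / N x.1) (highProb P) (𝓝 0) := by
  have hb_mem : exposure D P b ∈ unifL2 P N := exposure_mem_unifL2 hD.quasiRandom hD.ν_pos.le
    (fun S i s => (hb_meas S i s).mono (D S).F0_le le_rfl) hb
  have h_exposure := tendsto_regionAvg_exposure_mul_exposure hD.quasiRandom hD.ν_pos hD.C_nonneg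
    hD.tendsto_size hb_meas hR hb
  have h_lim := h_exposure.sub (tendsto_regionAvg_mul_zero hb_mem hD.controlError_negligible)
  rw [sub_zero] at h_lim
  refine h_lim.congr fun x => ?_
  rw [innovation, sub_mul, map_sub, Pi.sub_apply, mul_comm (exposure D P b)]
  ring

theorem tendsto_regionAvg_innovation_mul_self_sub (hD : IsRegular D P γ Q c ν C K) :
    Tendsto (fun x => regionAvg (innovation D P γ * innovation D P γ) x -
      (D x.1).totalWeight (P x.1) x.2 / N x.1) (highProb P) (𝓝 0) := by
  have h_exposure := hD.tendsto_regionAvg_innovation_mul_exposure_sub (b := 1) (R := 1)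
    (fun _ _ _ => measurable_const) zero_le_one fun S => .of_forall (by simp)
  have h_lim := h_exposure.sub
    (tendsto_regionAvg_mul_zero hD.innovation_mem hD.controlError_negligible)
  rw [sub_zero] at h_lim
  refine h_lim.congr fun x => ?_
  have h_weight : (D x.1).weightedSum (P x.1) ((1 : ∀ S, Fin (N S) → Fin S → Ω S → ℝ) x.1) x.2 =
      (D x.1).totalWeight (P x.1) x.2 := congrFun ((D x.1).weightedSum_one (P x.1)) x.2
  rw [h_weight, sub_right_comm, ← Pi.sub_apply, ← map_sub, ← mul_sub]
  rfl

theorem tendsto_regionAvg_innovation_mul_Y_sub (hD : IsRegular D P γ Q c ν C K) :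
    Tendsto (fun x => regionAvg (innovation D P γ * fun S i ω => (D S).Y ω i) x -
      (D x.1).weightedSum (P x.1) (D x.1).B x.2 / N x.1) (highProb P) (𝓝 0) := by
  have h_mean := hD.tendsto_regionAvg_innovation_mul_zero
    (f := (fun S => (D S).Y0) +
      fun S => (D S).aggregate (fun s => (P S)[(D S).XX s | (D S).F0]) (D S).B)
    (Submodule.add_mem _ hD.Y0_mem <| aggregate_condExp_mem_unifL2 hD.quasiRandom hD.ν_pos.le
      (fun S => (D S).measurable_B) hD.abs_B_le)
    fun S i => ((D S).F0_measurable_Y0 i).add <| Finset.measurable_fun_sum (m := (D S).F0) _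
      fun s _ => (((D S).F0_measurable_w i s).mul stronglyMeasurable_condExp.measurable).mul
        ((D S).F0_measurable_B i s)
  have h_exposure := hD.tendsto_regionAvg_innovation_mul_exposure_sub
    (fun S => (D S).F0_measurable_B) hD.K_nonneg hD.abs_B_le
  have h_error := tendsto_regionAvg_mul_zero hD.innovation_mem hD.L_negligible
  have h_lim := (h_mean.add h_exposure).add h_error
  simp only [add_zero] at h_lim
  refine h_lim.congr fun x => ?_
  simp only [Y_eq_add_exposure (P := P), mul_add, map_add, Pi.add_apply]
  ring

theorem tendsto_regionAvg_Z_mul_innovation (hD : IsRegular D P γ Q c ν C K) (k : Fin p) :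
    Tendsto (regionAvg ((fun S i ω => (D S).Z ω i k) * innovation D P γ)) (highProb P) (𝓝 0) := by
  rw [mul_comm]
  exact hD.tendsto_regionAvg_innovation_mul_zero (hD.Z_mem k) fun S i => (D S).F0_measurable_Z i k

theorem aggregate_XX_B_mem (hD : IsRegular D P γ Q c ν C K) :
    (fun S => (D S).aggregate (D S).XX (D S).B) ∈ unifL2 P N :=
  aggregate_XX_mem_unifL2 hD.quasiRandom hD.ν_pos.le (fun S => (D S).measurable_B) hD.abs_B_le

theorem bddInProb_regionAvg_Z_mul_Y (hD : IsRegular D P γ Q c ν C K) (k : Fin p) :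
    BddInProb P (regionAvg ((fun S i ω => (D S).Z ω i k) * fun S i ω => (D S).Y ω i)) := by
  have h_bdd := bddInProb_regionAvg_mul (hD.Z_mem k)
    (Submodule.add_mem _ hD.Y0_mem hD.aggregate_XX_B_mem)
  have h_error := BddInProb.of_tendsto <| tendsto_regionAvg_mul_zero (hD.Z_mem k) hD.L_negligible
  have h_Y : (fun S i ω => (D S).Y ω i) =
      (fun S => (D S).Y0) + (fun S => (D S).aggregate (D S).XX (D S).B) + fun S => (D S).L := rfl
  rw [h_Y, mul_add, map_add]
  exact h_bdd.add h_error

theorem tendsto_Xres_dotProduct_Y_sub (hD : IsRegular D P γ Q c ν C K) :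
    Tendsto (fun x : Σ S, Ω S => (D x.1).Xres x.2 ⬝ᵥ (D x.1).Y x.2 / N x.1 -
      (D x.1).weightedSum (P x.1) (D x.1).B x.2 / N x.1) (highProb P) (𝓝 0) := by
  have h_lim := (tendsto_olsResidual_dotProduct_div (Z := fun S => (D S).Z) hD.det_ne_zero
    hD.tendsto_gram hD.tendsto_regionAvg_Z_mul_innovation hD.bddInProb_regionAvg_Z_mul_Y).add
      hD.tendsto_regionAvg_innovation_mul_Y_sub
  rw [add_zero] at h_lim
  refine h_lim.congr' ?_
  filter_upwards [hD.eventually_Xres_eq] with x hx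
  rw [hx.2, sub_add_sub_cancel]

theorem tendsto_Xres_dotProduct_Xres_div (hD : IsRegular D P γ Q c ν C K) :
    Tendsto (fun x : Σ S, Ω S => (D x.1).Xres x.2 ⬝ᵥ (D x.1).Xres x.2 / N x.1) (highProb P)
      (𝓝 c) := by
  have h_gram := (tendsto_olsResidual_dotProduct_div (Z := fun S => (D S).Z) hD.det_ne_zero
    hD.tendsto_gram hD.tendsto_regionAvg_Z_mul_innovation fun k => .of_tendsto
      (hD.tendsto_regionAvg_Z_mul_innovation k)).add hD.tendsto_regionAvg_innovation_mul_self_sub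
  have h_lim := h_gram.add hD.tendsto_totalWeight_div
  rw [add_zero, zero_add] at h_lim
  refine h_lim.congr' ?_
  filter_upwards [hD.eventually_Xres_eq] with x hx
  rw [hx.2, olsResidual_dotProduct_olsResidual hx.1, sub_add_sub_cancel, sub_add_cancel]

theorem eventually_wellDefined (hD : IsRegular D P γ Q c ν C K) :
    ∀ᶠ x : Σ S, Ω S in highProb P, IsUnit (((D x.1).Z x.2)ᵀ * (D x.1).Z x.2).det ∧
      0 < (D x.1).Xres x.2 ⬝ᵥ (D x.1).Xres x.2 ∧ 0 < (D x.1).totalWeight (P x.1) x.2 := by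
  filter_upwards [hD.eventually_Xres_eq,
    hD.tendsto_Xres_dotProduct_Xres_div.eventually_const_lt hD.c_pos,
    hD.tendsto_totalWeight_div.eventually_const_lt hD.c_pos] with x hZ hX hT
  exact ⟨hZ.1, pos_of_mul_pos_left hX (inv_nonneg.2 (N x.1).cast_nonneg),
    pos_of_mul_pos_left hT (inv_nonneg.2 (N x.1).cast_nonneg)⟩

theorem tendsto_betaHat_sub_betaBar (hD : IsRegular D P γ Q c ν C K) :
    Tendsto (fun x : Σ S, Ω S => (D x.1).betaHat x.2 - (D x.1).betaBar (P x.1) x.2)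
      (highProb P) (𝓝 0) := by
  have h_abs_le : ∀ S, ∀ᵐ ω ∂P S, |(D S).betaBar (P S) ω| ≤ K := fun S =>
    abs_betaBar_le hD.K_nonneg (hD.abs_B_le S)
  exact tendsto_div_sub_div_of_abs_le hD.c_pos.ne' hD.tendsto_Xres_dotProduct_Y_sub
    hD.tendsto_Xres_dotProduct_Xres_div hD.tendsto_totalWeight_div
    (eventually_highProb_of_ae h_abs_le)

end IsRegular

end Regularity

end ShiftShare

theorem proposition3
    {Ω : ℕ → Type*} [∀ S, MeasurableSpace (Ω S)]
    (P : ∀ S, Measure (Ω S)) [∀ S, IsProbabilityMeasure (P S)]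
    (N : ℕ → ℕ) (p : ℕ) (γ : Fin p → ℝ)
    (D : ∀ S, ShiftShare S (N S) p (Ω S))
    -- shares
    (hw_nonneg : ∀ S i s, ∀ᵐ ω ∂P S, 0 ≤ (D S).w i s ω)
    (hw_sum : ∀ S i, ∀ᵐ ω ∂P S, ∑ s, (D S).w i s ω ≤ 1)
    -- shifters as good as randomly assigned given the sector-level controls, and independent
    (h_assign : ∀ S s, (P S)[(D S).XX s | (D S).F0] =ᵐ[P S]
      fun ω => ∑ k, (D S).ZZ s k ω * γ k)
    (h_indep : ∀ S, CondIndepGiven (D S).F0 (P S) (D S).XX)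
    -- no sector dominates
    (h_size : ConvInProb P (fun S ω => (⨆ s, (D S).n s ω) / N S) 0)
    -- the measurement error in the controls that matter vanishes on average
    (h_Uγ : Tendsto (fun S => (∑ i, ∫ ω, (∑ k, (D S).U i k ω * γ k) ^ 2 ∂P S) / N S)
      atTop (𝓝 0))
    -- bounded treatment effects
    (h_beta : ∃ C : ℝ, ∀ S i s, ∀ᵐ ω ∂P S, |(D S).B i s ω| ≤ C)
    -- the shifters have sufficient variation
    (h_var : ∃ c : ℝ, 0 < c ∧ ConvInProb P (fun S ω => (D S).totalWeight (P S) ω / N S) c)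
    -- moments of the shifters, of `Y(0)`, of `U` and of the sector-level controls
    (h_XX : ∃ ν C : ℝ, 0 < ν ∧ ∀ S s,
      CondMeanLE (D S).F0 (P S) (fun ω => |(D S).XX s ω| ^ (2 + ν)) C)
    (h_Y0 : ∃ C : ℝ, ∀ S i, CondMeanLE (D S).sigmaW (P S) (fun ω => (D S).Y0 i ω ^ 2) C)
    (h_U : ∃ C : ℝ, ∀ S i k, CondMeanLE (D S).sigmaW (P S) (fun ω => (D S).U i k ω ^ 2) C)
    (h_ZZ : ∃ C : ℝ, ∀ S s k, CondMeanLE (D S).sigmaW (P S) (fun ω => (D S).ZZ s k ω ^ 2) C)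
    -- the linearization error vanishes on average
    (h_L_int : ∀ S i, Integrable (fun ω => (D S).L i ω ^ 2) (P S))
    (h_L : Tendsto (fun S => (∑ i, √(∫ ω, (D S).L i ω ^ 2 ∂P S)) / N S) atTop (𝓝 0))
    -- the controls are not collinear
    (h_ZtZ : ∃ Q : Matrix (Fin p) (Fin p) ℝ, Q.PosDef ∧ ∀ k l,
      ConvInProb P (fun S ω => (((D S).Z ω)ᵀ * (D S).Z ω) k l / N S) (Q k l)) :
    -- the estimator and the estimand are well defined with probability approaching one
    Tendsto (fun S => P S {ω | ¬ (IsUnit (((D S).Z ω)ᵀ * (D S).Z ω).det ∧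
      0 < (D S).Xres ω ⬝ᵥ (D S).Xres ω ∧ 0 < (D S).totalWeight (P S) ω)}) atTop (𝓝 0) ∧
    -- consistency
    ConvInProb P (fun S ω => (D S).betaHat ω - (D S).betaBar (P S) ω) 0 ∧
    -- homogeneous effects
    (∀ b : ℕ → ℝ, (∀ S i s, ∀ᵐ ω ∂P S, (D S).B i s ω = b S) →
      Tendsto (fun S => P S {ω | (D S).betaBar (P S) ω ≠ b S}) atTop (𝓝 0) ∧
      ConvInProb P (fun S ω => (D S).betaHat ω - b S) 0) := by
  obtain ⟨K, hK⟩ := h_beta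
  obtain ⟨c, hc, h_var⟩ := h_var
  obtain ⟨ν, C, hν, hC⟩ := h_XX
  obtain ⟨Q, hQ, h_gram⟩ := h_ZtZ
  have h_shares : ∀ S, ∀ᵐ ω ∂P S, ∀ i, (∀ s, 0 ≤ (D S).w i s ω) ∧ ∑ s, (D S).w i s ω ≤ 1 :=
    fun S => ae_all_iff.2 fun i => (ae_all_iff.2 (hw_nonneg S i)).and (hw_sum S i)
  have h_quasi : ∀ S, (D S).IsQuasiRandom (P S) ν (max C 0) := fun S =>
    ⟨h_shares S, h_indep S, fun s =>
      ⟨(hC S s).1, (hC S s).2.mono fun ω h => h.trans (le_max_left C 0)⟩⟩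
  have h_abs_B : ∀ S, ∀ᵐ ω ∂P S, ∀ i s, |(D S).B i s ω| ≤ |K| := fun S =>
    ae_all_iff.2 fun i => ae_all_iff.2 fun s => (hK S i s).mono fun ω h => h.trans (le_abs_self K)
  have hD : ShiftShare.IsRegular D P γ Q c ν (max C 0) |K| :=
    { c_pos := hc, ν_pos := hν, C_nonneg := le_max_right C 0, K_nonneg := abs_nonneg K,
      quasiRandom := h_quasi, assign := fun S => ae_all_iff.2 (h_assign S), size := h_size,
      abs_B_le := h_abs_B, Y0_moment := h_Y0, U_moment := h_U, ZZ_moment := h_ZZ,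
      controlError_sq := h_Uγ, L_sq_integrable := h_L_int, L_rms := h_L, variance := h_var,
      det_ne_zero := hQ.det_pos.ne', gram := h_gram }
  have h_lim := hD.tendsto_betaHat_sub_betaBar
  refine ⟨eventually_highProb.1 hD.eventually_wellDefined,
    convInProb_iff_tendsto_highProb.2 h_lim, fun β hβ => ?_⟩
  have h_eq := hD.eventually_betaBar_eq hβ
  refine ⟨eventually_highProb.1 h_eq, convInProb_iff_tendsto_highProb.2 (h_lim.congr' ?_)⟩
  exact h_eq.mono fun x hx => congrArg ((D x.1).betaHat x.2 - ·) hx
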